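/- Let $d\in\mathbb N$, $T>0$, let $\|\cdot\|$ be the Euclidean norm on $\mathbb R^d$, and let $C([0,T];\mathbb R^d)$ carry the distance $\sup_{0\le t\le T}\|x_t-y_t\|$ and its Borel $\sigma$-algebra. **Test functions.** Let $\Phi$ be a set of functions $\mathbb R^d\to\mathbb R$ and $A_1,A_2,A_3>0$ constants such that: (i) if $\nu$ is a finite signed measure on $\mathbb R^d$ such that every $f\in\Phi$ is $\nu$-integrable with $\int f\,\mathrm d\nu=0$, then $\nu=0$; (ii) every $f\in\Phi$ satisfies $|f(x)-f(y)|\le A_1\|x-y\|$ for all $x,y$, and $|f(0)|\le A_2$; (iii) for all $n\ge1$ and $x^1,\dots,x^n\in\mathbb R^d$, $$\frac1n\,\mathbb E\sup_{f\in\Phi}\Bigl|\sum_{i=1}^n\xi_i f(x^i)\Bigr|\le\frac{A_3}{n}\sqrt{\sum_{i=1}^n(\|x^i\|^2+1)},$$ where $\xi_1,\dots,\xi_n$ are independent with $\mathbb P(\xi_i=1)=\mathbb P(\xi_i=-1)=\tfrac12$. For probability measures $\mu,\mu'$ on $\mathbb R^d$ with finite first moment put $\mathrm D_\Phi(\mu,\mu')=\sup_{f\in\Phi}\bigl|\int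 f\,\mathrm d\mu-\int f\,\mathrm d\mu'\bigr|$. **The law.** Let $\mu$ be a probability measure on $C([0,T];\mathbb R^d)$ with $$M:=\int\sup_{0\le t\le T}\|x_t\|^2\,\mathrm d\mu(x)<\infty,$$ and let $Q,\alpha,\beta>0$ be such that for every $0<h\le T$ $$\int\Delta(x,h)\,\mathrm d\mu(x)\le Q\,h^\alpha\log^\beta\Bigl(\frac{2T}{h}\Bigr),\qquad \Delta(x,h)=\sup_{s,t\in[0,T],\,|t-s|\le h}\|x_t-x_s\|.$$ Let $\mu_t$ denote the law of $x_t$ under $\mu$, and for $n\ge1$ define $$\phi(n)=2\left[\frac{A_3+8\max\{A_1,A_2\}}{\sqrt n}+8\max\{A_1,A_2\}\sqrt{\frac{\log(2^{2\alpha}n)}{2\alpha n}}\right](M+1)^{1/2}+\frac{2A_1QT^\alpha}{\sqrt n}\left(\frac{\log(2^{4\alpha}n)}{2\alpha}\right)^{\beta}.$$ **Theorem.** As $n\to\infty$, $\phi(n)=O\bigl(n^{-1/2}(\log n)^{\max\{\beta,1/2\}}\bigr)$. Moreover, for every $n\ge1$ and all i.i.d. random paths $X^1,\dots,X^n$ with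 law $\mu$, with empirical measures $\bar\mu^n_t=\frac1n\sum_{i=1}^n\delta_{X^i_t}$, the quantity $\sup_{0\le t\le T}\mathrm D_\Phi(\mu_t,\bar\mu^n_t)$ is a random variable and: (a) $$\mathbb E\Bigl[\sup_{0\le t\le T}\mathrm D_\Phi(\mu_t,\bar\mu^n_t)\Bigr]\le\phi(n),\qquad \mathbb E\Bigl[\sup_{0\le t\le T}\mathrm D_\Phi^2(\mu_t,\bar\mu^n_t)\Bigr]\le\frac{A_1^2}{n}M+\phi(n)^2.$$ (b) If $\kappa>0$ and $\mu$ satisfies the $\mathrm T_1$ inequality $\mathcal W_1^2(\mu,\tilde\mu)\le2\kappa^2\,\mathcal H(\tilde\mu|\mu)$ for all probability measures $\tilde\mu\ll\mu$ on $C([0,T];\mathbb R^d)$, where $\mathcal W_1$ is the 1-Wasserstein distance for the uniform distance and $\mathcal H(\tilde\mu|\mu)=\int\frac{\mathrm d\tilde\mu}{\mathrm d\mu}\log\frac{\mathrm d\tilde\mu}{\mathrm d\mu}\,\mathrm d\mu$, then for every $a\ge0$ $$\mathbb P\Bigl(\sup_{0\le t\le T}\mathrm D_\Phi(\mu_t,\bar\mu^n_t)-\phi(n)\ge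 a\Bigr)\le\exp\Bigl(-\frac{na^2}{2A_1^2\kappa^2}\Bigr).$$ -/

import Mathlib

open MeasureTheory ProbabilityTheory Filter
open scoped ENNReal

noncomputable section

namespace GMMD

/-- The Euclidean space `ℝ^d` with the `ℓ²` norm. -/
abbrev Eucl (d : ℕ) : Type := EuclideanSpace ℝ (Fin d)

/-- The path space `C([0,T]; ℝ^d)`. Its Mathlib norm and distance are those of uniform convergence,
`‖x‖ = sup_t ‖x t‖`. -/
abbrev PathSpace (d : ℕ) (T : ℝ) : Type := C(Set.Icc (0 : ℝ) T, Eucl d)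

/-- The path space carries the Borel σ-algebra of the uniform topology. -/
instance instMeasurableSpacePathSpace (d : ℕ) (T : ℝ) : MeasurableSpace (PathSpace d T) :=
  borel _

instance instBorelSpacePathSpace (d : ℕ) (T : ℝ) : BorelSpace (PathSpace d T) := ⟨rfl⟩

/-- The generalized maximum mean discrepancy `D_Φ(μ, ν) = sup_{f ∈ Φ} |∫ f dμ - ∫ f dν|`, as an
extended nonnegative real, so that no convention about unbounded suprema is involved. -/
def gmmd {d : ℕ} (Φ : Set (Eucl d → ℝ)) (μ ν : Measure (Eucl d)) : ℝ≥0∞ :=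
  ⨆ f ∈ Φ, ‖(∫ y, f y ∂μ) - ∫ y, f y ∂ν‖ₑ

/-- The empirical Rademacher complexity `(1/n) E sup_{f ∈ Φ} |∑ i, ξ i * f (x i)|`. The expectation
over independent uniform signs `ξ i = ±1` is the average over the `2^n` sign vectors
(`ℤˣ = {1, -1}`). -/
def rademacherComplexity {d n : ℕ} (Φ : Set (Eucl d → ℝ)) (x : Fin n → Eucl d) : ℝ≥0∞ :=
  (n : ℝ≥0∞)⁻¹ * ((2 ^ n : ℝ≥0∞)⁻¹ *
    ∑ ξ : Fin n → ℤˣ, ⨆ f ∈ Φ, ‖∑ i, ((ξ i : ℤ) : ℝ) * f (x i)‖ₑ)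

/-- The assumption on the class of test functions, with its constants `A₁, A₂, A₃`. -/
structure FunctionClass {d : ℕ} (Φ : Set (Eucl d → ℝ)) (A₁ A₂ A₃ : ℝ) : Prop where
  A₁_pos : 0 < A₁
  A₂_pos : 0 < A₂
  A₃_pos : 0 < A₃
  /-- A finite signed measure which integrates every `f ∈ Φ` to zero vanishes. -/
  separating : ∀ ν : SignedMeasure (Eucl d),
    (∀ f ∈ Φ, ν.Integrable f ∧ ∫ᵛ y, f y ∂•ν = 0) → ν = 0
  lipschitz : ∀ f ∈ Φ, ∀ x y : Eucl d, |f x - f y| ≤ A₁ * ‖x - y‖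
  bound_zero : ∀ f ∈ Φ, |f 0| ≤ A₂
  rademacher : ∀ n : ℕ, 0 < n → ∀ x : Fin n → Eucl d,
    rademacherComplexity Φ x ≤ ENNReal.ofReal (A₃ / n * √(∑ i, (‖x i‖ ^ 2 + 1)))

/-- The modulus of continuity `Δ(x, h) = sup {‖x t - x s‖ : t, s ∈ [0,T], |t - s| ≤ h}`. -/
def modulus {d : ℕ} {T : ℝ} (x : PathSpace d T) (h : ℝ) : ℝ≥0∞ :=
  ⨆ (t : Set.Icc (0 : ℝ) T) (s : Set.Icc (0 : ℝ) T) (_ : |(t : ℝ) - s| ≤ h), ‖x t - x s‖ₑ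

/-- The assumption on the modulus of continuity of a law on path space, with its constants
`Q, α, β`. The scale `h` ranges over `(0, T]`. -/
structure ModulusBound {d : ℕ} {T : ℝ} (μ : Measure (PathSpace d T)) (Q α β : ℝ) : Prop where
  Q_pos : 0 < Q
  α_pos : 0 < α
  β_pos : 0 < β
  bound : ∀ h : ℝ, 0 < h → h ≤ T →
    ∫⁻ x, modulus x h ∂μ ≤ ENNReal.ofReal (Q * h ^ α * Real.log (2 * T / h) ^ β)

/-- The time marginal `μ_t` of a law on path space. -/
def marginal {d : ℕ} {T : ℝ} (μ : Measure (PathSpace d T)) (t : Set.Icc (0 : ℝ) T) :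
    Measure (Eucl d) :=
  μ.map (fun x => x t)

/-- The empirical measure `(1/n) ∑ i, δ_{x i}`. -/
def empirical {d n : ℕ} (x : Fin n → Eucl d) : Measure (Eucl d) :=
  (n : ℝ≥0∞)⁻¹ • ∑ i, Measure.dirac (x i)

/-- The Wasserstein distance `W₁`: the infimum over couplings of the expected distance. -/
def wasserstein₁ {E : Type*} [PseudoEMetricSpace E] [MeasurableSpace E] (μ ν : Measure E) :
    ℝ≥0∞ :=
  ⨅ (γ : Measure (E × E)) (_ : γ.map Prod.fst = μ ∧ γ.map Prod.snd = ν),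
    ∫⁻ z, edist z.1 z.2 ∂γ

/-- The transport inequality `T₁` with constant `κ`: `W₁(μ, ν)² ≤ 2 κ² H(ν | μ)` for all
probability measures `ν ≪ μ`, where the relative entropy `H(ν | μ)` is Mathlib's `klDiv ν μ`. -/
def TransportInequality₁ {E : Type*} [PseudoEMetricSpace E] [MeasurableSpace E]
    (μ : Measure E) (κ : ℝ) : Prop :=
  ∀ ν : Measure E, IsProbabilityMeasure ν → ν ≪ μ →
    wasserstein₁ μ ν ^ 2 ≤ ENNReal.ofReal (2 * κ ^ 2) * InformationTheory.klDiv ν μ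

/-- `∫ sup_{0 ≤ t ≤ T} ‖x t‖² dμ(x)`. -/
def supSecondMoment {d : ℕ} {T : ℝ} (μ : Measure (PathSpace d T)) : ℝ :=
  ∫ x, (⨆ t, ‖x t‖ ^ 2) ∂μ

/-- The explicit rate `φ(n)`; the parameter `M` stands for `∫ sup_t ‖x t‖² dμ`. -/
def rate (T A₁ A₂ A₃ Q α β M : ℝ) (n : ℕ) : ℝ :=
  2 * ((A₃ + 8 * max A₁ A₂) / √n +
      8 * max A₁ A₂ * √(Real.log (2 ^ (2 * α) * n) / (2 * α * n))) * (M + 1) ^ (1 / 2 : ℝ) +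
    2 * (A₁ * Q * T ^ α / √n) * (Real.log (2 ^ (4 * α) * n) / (2 * α)) ^ β

end GMMD

end

noncomputable section

namespace GMMD

/-! ### Concentration for Rademacher signs -/

/-! Let Z be the discrepancy of the sample, uniform in time. As a function of the n independent
paths, Z is A₁/n-Lipschitz in each of them for the uniform distance. It is therefore enough to bound
its mean by φ(n); the second moment and the tail then follow by tensorization.

Mean. Comparison with an independent copy of the sample bounds E Z by 2/n times the expectation of
sup over t and f of |∑ ξᵢ f(Xⁱ_t)|, with independent signs ξᵢ. For frozen paths, put S = √(∑ (‖xⁱ‖²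
+ 1)). At one fixed time the average over the signs is at most A₃ S by the Rademacher hypothesis.
The supremum over f has bounded differences in the signs, hence sub-Gaussian exponential moments
with variance proxy of order max(A₁, A₂)² S², so a maximum over k grid times costs only a further
term of order max(A₁, A₂) S √(log k) (`sign_average_sup_le`). Passing from the grid of mesh at most
h to all times costs A₁ ∑ Δ(xⁱ, h). After integration E S ≤ √(n (M + 1)), and h = T n^(-1/(2α))
makes h^α = T^α / √n, so that every term is n^(-1/2) up to logarithms
(`lintegral_pathGmmd_le_rate`).

Second moment. The variance of Z is at most n (A₁/n)² M, coordinate by coordinate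
(`lintegral_sq_pi_le`).

Tail. Applying T₁ to exponential tilts of μ gives Gaussian bounds for the exponential moments of
Lipschitz functions (`integral_exp_le_of_transport`). These bounds multiply over independent
coordinates (`lintegral_exp_pi_le`), and Markov's inequality for the exponential concludes. -/

lemma sum_sign_cons {n : ℕ} (F : (Fin (n + 1) → ℤˣ) → ℝ) :
    ∑ ξ, F ξ = ∑ η : Fin n → ℤˣ, (F (Fin.cons 1 η) + F (Fin.cons (-1) η)) := by
  rw [← (Fin.consEquiv (fun _ : Fin (n + 1) => ℤˣ)).sum_comp, Fintype.sum_prod_type_right]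
  refine Finset.sum_congr rfl fun η _ => ?_
  have : (Finset.univ : Finset ℤˣ) = {1, -1} := rfl
  rw [this, Finset.sum_pair (by decide)]
  rfl

/-- A bounded-differences exponential moment bound for functions of independent signs. -/
theorem sign_average_exp_le {n : ℕ} (g : (Fin n → ℤˣ) → ℝ) (b : Fin n → ℝ)
    (hg : ∀ ξ η, |g ξ - g η| ≤ ∑ i, |((ξ i : ℤ) : ℝ) - ((η i : ℤ) : ℝ)| * b i) :
    (2 ^ n : ℝ)⁻¹ * ∑ ξ, Real.exp (g ξ) ≤
      Real.exp ((2 ^ n : ℝ)⁻¹ * ∑ ξ, g ξ + (∑ i, b i ^ 2) / 2) := by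
  induction n with
  | zero => simp
  | succ n ih =>
    -- Averaging out the first sign preserves the bounded differences in the others, so the
    -- induction hypothesis applies to `G`.
    set G : (Fin n → ℤˣ) → ℝ := fun η => (g (Fin.cons 1 η) + g (Fin.cons (-1) η)) / 2 with hG
    have hGl : ∀ ξ η, |G ξ - G η| ≤
        ∑ i, |((ξ i : ℤ) : ℝ) - ((η i : ℤ) : ℝ)| * b i.succ := by
      intro ξ η
      have h1 := hg (Fin.cons 1 ξ) (Fin.cons 1 η)
      have h2 := hg (Fin.cons (-1) ξ) (Fin.cons (-1) η)
      simp only [Fin.sum_univ_succ, Fin.cons_zero, Fin.cons_succ, sub_self, abs_zero, zero_mul,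
        zero_add] at h1 h2
      rw [abs_le] at *
      simp only [hG]
      constructor <;> linarith [h1.1, h1.2, h2.1, h2.2]
    have key : ∀ η, Real.exp (g (Fin.cons 1 η)) + Real.exp (g (Fin.cons (-1) η)) ≤
        2 * Real.exp (b 0 ^ 2 / 2) * Real.exp (G η) := by
      intro η
      -- The two values are `G η ± u`. Flipping a sign moves it by 2, so the half-difference
      -- satisfies |u| ≤ b 0, and cosh u ≤ exp(u²/2) gives the factor.
      set u := (g (Fin.cons 1 η) - g (Fin.cons (-1) η)) / 2 with hu
      have hub : |u| ≤ b 0 := by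
        have h := hg (Fin.cons 1 η) (Fin.cons (-1) η)
        simp only [Fin.sum_univ_succ, Fin.cons_zero, Fin.cons_succ, sub_self, abs_zero, zero_mul,
          Finset.sum_const_zero, add_zero] at h
        norm_num at h
        rw [hu, abs_div]
        norm_num
        linarith
      have h1 : g (Fin.cons 1 η) = G η + u := by simp only [hG, hu]; ring
      have h2 : g (Fin.cons (-1) η) = G η + -u := by simp only [hG, hu]; ring
      have hsq : u ^ 2 ≤ b 0 ^ 2 := sq_le_sq' (by linarith [(abs_le.1 hub).1]) (abs_le.1 hub).2
      have hc := (Real.cosh_le_exp_half_sq u).trans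
        (Real.exp_le_exp.2 (by linarith : u ^ 2 / 2 ≤ b 0 ^ 2 / 2))
      rw [Real.cosh_eq] at hc
      rw [h1, h2, Real.exp_add, Real.exp_add]
      nlinarith [Real.exp_pos (G η)]
    have hsum : ∑ ξ, g ξ = 2 * ∑ η, G η := by
      rw [sum_sign_cons, Finset.mul_sum]
      exact Finset.sum_congr rfl fun η _ => by simp only [hG]; ring
    have hI := ih G (fun i => b i.succ) hGl
    calc (2 ^ (n + 1) : ℝ)⁻¹ * ∑ ξ, Real.exp (g ξ)
        ≤ (2 ^ (n + 1) : ℝ)⁻¹ * ∑ η, 2 * Real.exp (b 0 ^ 2 / 2) * Real.exp (G η) := by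
          rw [sum_sign_cons]
          gcongr with η
          exact key η
      _ = Real.exp (b 0 ^ 2 / 2) * ((2 ^ n : ℝ)⁻¹ * ∑ η, Real.exp (G η)) := by
          rw [← Finset.mul_sum, pow_succ]; field_simp
      _ ≤ Real.exp (b 0 ^ 2 / 2) *
            Real.exp ((2 ^ n : ℝ)⁻¹ * ∑ ξ, G ξ + (∑ i : Fin n, b i.succ ^ 2) / 2) := by gcongr
      _ = _ := by
          rw [← Real.exp_add, hsum, Fin.sum_univ_succ (fun i => b i ^ 2), pow_succ]
          congr 1
          field_simp
          ring

/-- The average over the signs of a finite maximum of functions with bounded differences. -/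
theorem sign_average_sup_le {n : ℕ} {J : Type*} [Fintype J] [Nonempty J]
    (g : J → (Fin n → ℤˣ) → ℝ) (b : Fin n → ℝ) (A lam V : ℝ) (hlam : 0 < lam)
    (hV : ∑ i, b i ^ 2 ≤ V)
    (hg : ∀ j ξ η, |g j ξ - g j η| ≤ ∑ i, |((ξ i : ℤ) : ℝ) - ((η i : ℤ) : ℝ)| * b i)
    (hA : ∀ j, (2 ^ n : ℝ)⁻¹ * ∑ ξ, g j ξ ≤ A)
    (u : (Fin n → ℤˣ) → ℝ) (hu : ∀ ξ, ∃ j, u ξ ≤ g j ξ) :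
    (2 ^ n : ℝ)⁻¹ * ∑ ξ, u ξ ≤ A + Real.log (Fintype.card J) / lam + lam * V / 2 := by
  set k : ℝ := (Fintype.card J : ℝ) with hk
  have hk0 : 0 < k := by simp [hk, Fintype.card_pos]
  set K : ℝ := k * Real.exp (lam ^ 2 * V / 2) with hK
  have hK0 : 0 < K := by positivity
  have havg : ∀ c : ℝ, (2 ^ n : ℝ)⁻¹ * ∑ _ξ : Fin n → ℤˣ, c = c := by
    intro c
    simp [Finset.sum_const, Finset.card_univ, Fintype.card_pi]
  have hj : ∀ j, (2 ^ n : ℝ)⁻¹ * ∑ ξ, Real.exp (lam * (g j ξ - A)) ≤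
      Real.exp (lam ^ 2 * V / 2) := by
    intro j
    have h := sign_average_exp_le (fun ξ => lam * (g j ξ - A)) (fun i => lam * b i) (by
      intro ξ η
      have : lam * (g j ξ - A) - lam * (g j η - A) = lam * (g j ξ - g j η) := by ring
      rw [this, abs_mul, abs_of_pos hlam]
      refine (mul_le_mul_of_nonneg_left (hg j ξ η) hlam.le).trans_eq ?_
      rw [Finset.mul_sum]
      exact Finset.sum_congr rfl fun i _ => by ring)
    refine h.trans (Real.exp_le_exp.2 ?_)
    have h1 : (2 ^ n : ℝ)⁻¹ * ∑ ξ, lam * (g j ξ - A) ≤ 0 := by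
      rw [← Finset.mul_sum, Finset.sum_sub_distrib, mul_left_comm, mul_sub, havg]
      nlinarith [hA j]
    have h2 : ∑ i, (lam * b i) ^ 2 ≤ lam ^ 2 * V := by
      simp_rw [mul_pow]
      rw [← Finset.mul_sum]
      gcongr
    linarith
  have hexp : (2 ^ n : ℝ)⁻¹ * ∑ ξ, Real.exp (lam * (u ξ - A)) ≤ K := by
    calc (2 ^ n : ℝ)⁻¹ * ∑ ξ, Real.exp (lam * (u ξ - A))
        ≤ (2 ^ n : ℝ)⁻¹ * ∑ ξ, ∑ j, Real.exp (lam * (g j ξ - A)) := by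
          gcongr with ξ
          obtain ⟨j, hjξ⟩ := hu ξ
          refine le_trans ?_ (Finset.single_le_sum
            (f := fun j => Real.exp (lam * (g j ξ - A))) (fun _ _ => (Real.exp_pos _).le)
            (Finset.mem_univ j))
          gcongr
      _ = ∑ j, (2 ^ n : ℝ)⁻¹ * ∑ ξ, Real.exp (lam * (g j ξ - A)) := by
          rw [Finset.sum_comm, Finset.mul_sum]
      _ ≤ ∑ _j : J, Real.exp (lam ^ 2 * V / 2) := Finset.sum_le_sum fun j _ => hj j
      _ = K := by simp [hK, hk]
  -- Jensen's inequality for the logarithm, through its tangent line at `K`: log y ≤ log K - 1 + y /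
  -- K.
  have hpt : ∀ ξ, lam * (u ξ - A) ≤ Real.log K - 1 + K⁻¹ * Real.exp (lam * (u ξ - A)) := by
    intro ξ
    have h := Real.add_one_le_exp (lam * (u ξ - A) - Real.log K)
    rw [Real.exp_sub, Real.exp_log hK0, div_eq_inv_mul] at h
    linarith
  have hmean : lam * ((2 ^ n : ℝ)⁻¹ * ∑ ξ, u ξ - A) ≤ Real.log K := by
    have h1 : lam * ((2 ^ n : ℝ)⁻¹ * ∑ ξ, u ξ - A) =
        (2 ^ n : ℝ)⁻¹ * ∑ ξ, lam * (u ξ - A) := by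
      rw [← Finset.mul_sum, Finset.sum_sub_distrib, mul_left_comm, mul_sub (2 ^ n : ℝ)⁻¹, havg]
    have h2 : (2 ^ n : ℝ)⁻¹ * ∑ ξ, lam * (u ξ - A) ≤
        (2 ^ n : ℝ)⁻¹ * ∑ ξ, (Real.log K - 1 + K⁻¹ * Real.exp (lam * (u ξ - A))) := by
      gcongr with ξ
      exact hpt ξ
    rw [Finset.sum_add_distrib, mul_add, havg, ← Finset.mul_sum _ _ K⁻¹,
      mul_left_comm _ K⁻¹] at h2
    have h3 : K⁻¹ * ((2 ^ n : ℝ)⁻¹ * ∑ ξ, Real.exp (lam * (u ξ - A))) ≤ 1 := by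
      rw [inv_mul_le_iff₀ hK0, mul_one]
      exact hexp
    linarith
  have hlog : Real.log K = Real.log k + lam ^ 2 * V / 2 := by
    rw [hK, Real.log_mul hk0.ne' (Real.exp_pos _).ne', Real.log_exp]
  rw [hlog] at hmean
  have h4 : (2 ^ n : ℝ)⁻¹ * ∑ ξ, u ξ - A ≤ (Real.log k + lam ^ 2 * V / 2) / lam := by
    rw [le_div_iff₀ hlam]; linarith
  have h5 : (Real.log k + lam ^ 2 * V / 2) / lam = Real.log k / lam + lam * V / 2 := by
    field_simp
  linarith

/-! ### Tensorization for functions which are Lipschitz in each coordinate -/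

section Tensor

variable {E : Type*} [PseudoMetricSpace E]

/-- `g` is `c`-Lipschitz for the `ℓ¹` sum of the distances of the coordinates. -/
def CoordLipschitz {n : ℕ} (c : ℝ) (g : (Fin n → E) → ℝ) : Prop :=
  ∀ x y, |g x - g y| ≤ c * ∑ i, dist (x i) (y i)

lemma CoordLipschitz.continuous {n : ℕ} {c : ℝ} (hc : 0 ≤ c) {g : (Fin n → E) → ℝ}
    (hg : CoordLipschitz c g) : Continuous g := by
  refine (LipschitzWith.of_dist_le' (K := c * n) fun x y => ?_).continuous
  rw [Real.dist_eq, mul_assoc]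
  refine (hg x y).trans (mul_le_mul_of_nonneg_left ?_ hc)
  calc ∑ i, dist (x i) (y i) ≤ ∑ _i : Fin n, dist x y :=
        Finset.sum_le_sum fun i _ => dist_le_pi_dist x y i
    _ = n * dist x y := by simp

lemma lintegral_pi_succ {E : Type*} [MeasurableSpace E] {n : ℕ} (μ : Measure E) [IsProbabilityMeasure μ]
    {F : (Fin (n + 1) → E) → ℝ≥0∞} (hF : Measurable F) :
    ∫⁻ x, F x ∂(Measure.pi fun _ : Fin (n + 1) => μ) =
      ∫⁻ y, ∫⁻ x, F (Fin.cons x y) ∂μ ∂(Measure.pi fun _ : Fin n => μ) := by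
  have h := (measurePreserving_piFinSuccAbove (fun _ : Fin (n + 1) => μ) 0).symm
  rw [← h.lintegral_comp hF, lintegral_prod_symm]
  · simp [MeasurableEquiv.piFinSuccAbove, Fin.consEquiv]
  · exact (hF.comp (MeasurableEquiv.measurable _)).aemeasurable

lemma integral_pi_succ {E : Type*} [MeasurableSpace E] {n : ℕ} (μ : Measure E) [IsProbabilityMeasure μ]
    {F : (Fin (n + 1) → E) → ℝ} (hF : Integrable F (Measure.pi fun _ : Fin (n + 1) => μ)) :
    ∫ x, F x ∂(Measure.pi fun _ : Fin (n + 1) => μ) =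
      ∫ y, ∫ x, F (Fin.cons x y) ∂μ ∂(Measure.pi fun _ : Fin n => μ) := by
  have h := (measurePreserving_piFinSuccAbove (fun _ : Fin (n + 1) => μ) 0).symm
  rw [← h.integral_comp', integral_prod_symm]
  · simp [MeasurableEquiv.piFinSuccAbove, Fin.consEquiv]
  · exact (h.integrable_comp_emb (MeasurableEquiv.measurableEmbedding _)).2 hF

variable [MeasurableSpace E] [BorelSpace E] [SecondCountableTopology E]

lemma CoordLipschitz.integrable {n : ℕ} {c : ℝ} (hc : 0 ≤ c) {g : (Fin n → E) → ℝ}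
    (hg : CoordLipschitz c g) (μ : Measure E) [IsProbabilityMeasure μ] (o : E)
    (ho : Integrable (fun x => dist x o) μ) :
    Integrable g (Measure.pi fun _ : Fin n => μ) := by
  have hi : Integrable (fun x : Fin n → E => |g fun _ => o| + c * ∑ i, dist (x i) o)
      (Measure.pi fun _ : Fin n => μ) := by
    refine (integrable_const _).add ((integrable_finsetSum _ fun i _ => ?_).const_mul c)
    exact integrable_comp_eval (μ := fun _ : Fin n => μ) (i := i) (f := fun x => dist x o) ho
  refine hi.mono' (hg.continuous hc).measurable.aestronglyMeasurable (.of_forall fun x => ?_)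
  rw [Real.norm_eq_abs]
  have h := hg x fun _ => o
  have := abs_sub_abs_le_abs_sub (g x) (g fun _ => o)
  linarith

/-- Iteration of a one-dimensional functional inequality over the coordinates of a power. -/
theorem lintegral_pi_le_of_lintegral_le (μ : Measure E) [IsProbabilityMeasure μ] {c : ℝ}
    (hc : 0 ≤ c) (o : E) (ho : Integrable (fun x => dist x o) μ) (ψ : ℕ → ℝ → ℝ≥0∞)
    (hψ : ∀ k, Measurable (ψ k))
    (hμ : ∀ k, ∀ h : E → ℝ, (∀ x y, |h x - h y| ≤ c * dist x y) →
      ∫⁻ x, ψ k (h x) ∂μ ≤ ψ (k + 1) (∫ x, h x ∂μ))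
    (n : ℕ) (k : ℕ) (g : (Fin n → E) → ℝ) (hg : CoordLipschitz c g) :
    ∫⁻ x, ψ k (g x) ∂(Measure.pi fun _ : Fin n => μ) ≤
      ψ (k + n) (∫ x, g x ∂(Measure.pi fun _ : Fin n => μ)) := by
  induction n generalizing k with
  | zero =>
    have h : ∀ x, g x = g default := fun x => congrArg g (Subsingleton.elim _ _)
    simp [h]
  | succ n ih =>
    have hsec : ∀ y : Fin n → E, ∀ x x',
        |g (Fin.cons x y) - g (Fin.cons x' y)| ≤ c * dist x x' := by
      intro y x x'
      simpa [Fin.sum_univ_succ] using hg (Fin.cons x y) (Fin.cons x' y)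
    have hseci : ∀ y : Fin n → E, Integrable (fun x => g (Fin.cons x y)) μ := by
      intro y
      refine ((ho.const_mul c).add (integrable_const |g (Fin.cons o y)|)).mono' ?_
        (.of_forall fun x => ?_)
      · exact ((hg.continuous hc).comp (by fun_prop)).measurable.aestronglyMeasurable
      · have := abs_sub_abs_le_abs_sub (g (Fin.cons x y)) (g (Fin.cons o y))
        have := hsec y x o
        simp only [Real.norm_eq_abs, Pi.add_apply]
        linarith
    -- Integrating out one coordinate keeps the Lipschitz constant in the others. The index of `ψ`
    -- counts the coordinates already integrated.
    set G : (Fin n → E) → ℝ := fun y => ∫ x, g (Fin.cons x y) ∂μ with hG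
    have hGl : CoordLipschitz c G := by
      intro y y'
      simp only [hG]
      rw [← integral_sub (hseci y) (hseci y'), ← Real.norm_eq_abs]
      refine (norm_integral_le_of_norm_le_const (C := c * ∑ i, dist (y i) (y' i))
        (.of_forall fun x => ?_)).trans_eq (by simp)
      simpa [Fin.sum_univ_succ] using hg (Fin.cons x y) (Fin.cons x y')
    rw [lintegral_pi_succ μ (F := fun x => ψ k (g x)) ((hψ k).comp (hg.continuous hc).measurable),
      integral_pi_succ μ (hg.integrable hc μ o ho)]
    calc _ ≤ ∫⁻ y, ψ (k + 1) (G y) ∂(Measure.pi fun _ : Fin n => μ) :=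
          lintegral_mono fun y => hμ k _ (hsec y)
      _ ≤ ψ (k + 1 + n) (∫ y, G y ∂(Measure.pi fun _ : Fin n => μ)) := ih (k + 1) G hGl
      _ = _ := by rw [add_assoc, add_comm 1 n]

/-- The Efron–Stein second moment bound. -/
theorem lintegral_sq_pi_le (μ : Measure E) [IsProbabilityMeasure μ] {c : ℝ}
    (hc : 0 ≤ c) (o : E) (ho : Integrable (fun x => dist x o ^ 2) μ)
    (n : ℕ) (g : (Fin n → E) → ℝ) (hg : CoordLipschitz c g) :
    ∫⁻ x, ENNReal.ofReal (g x ^ 2) ∂(Measure.pi fun _ : Fin n => μ) ≤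
      ENNReal.ofReal ((∫ x, g x ∂(Measure.pi fun _ : Fin n => μ)) ^ 2 +
        n * (c ^ 2 * ∫ x, dist x o ^ 2 ∂μ)) := by
  have hmd : Measurable fun x : E => dist x o := (continuous_id.dist continuous_const).measurable
  have ho1 : Integrable (fun x => dist x o) μ := by
    refine (ho.add (integrable_const (1 : ℝ))).mono' hmd.aestronglyMeasurable
      (.of_forall fun x => ?_)
    simp only [Real.norm_eq_abs, Pi.add_apply, abs_of_nonneg dist_nonneg]
    nlinarith [sq_nonneg (dist x o - 1)]
  set V := c ^ 2 * ∫ x, dist x o ^ 2 ∂μ with hV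
  have hV0 : 0 ≤ V := mul_nonneg (sq_nonneg _) (integral_nonneg fun x => sq_nonneg _)
  -- With ψ k u = u² + kV, the one-coordinate inequality says that the variance of a `c`-Lipschitz
  -- function is at most V.
  have h := lintegral_pi_le_of_lintegral_le μ hc o ho1
    (fun k u => ENNReal.ofReal (u ^ 2 + k * V)) (fun k => by fun_prop) ?_ n 0 g hg
  · simpa using h
  intro k h hh
  have hcont : Continuous h := (LipschitzWith.of_dist_le' (K := c) fun x y => by
    rw [Real.dist_eq]; exact hh x y).continuous
  have hsub : ∀ x, (h x - h o) ^ 2 ≤ c ^ 2 * dist x o ^ 2 := fun x => by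
    rw [← mul_pow, ← sq_abs (h x - h o)]
    exact pow_le_pow_left₀ (abs_nonneg _) (hh x o) 2
  have hi : Integrable h μ := by
    refine ((ho1.const_mul c).add (integrable_const |h o|)).mono'
      hcont.measurable.aestronglyMeasurable (.of_forall fun x => ?_)
    have := abs_sub_abs_le_abs_sub (h x) (h o)
    have := hh x o
    simp only [Real.norm_eq_abs, Pi.add_apply]
    linarith
  have hiw : Integrable (fun x => (h x - h o) ^ 2) μ :=
    (ho.const_mul (c ^ 2)).mono' (by fun_prop) (.of_forall fun x => by
      rw [Real.norm_eq_abs, abs_of_nonneg (sq_nonneg _)]; exact hsub x)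
  -- Expansion about `h o`: with m = ∫ h, it gives ∫ h² ≤ V + 2 h(o) m - h(o)² ≤ V + m², the last
  -- step being (m - h(o))² ≥ 0.
  have hexp : (fun x => h x ^ 2) = fun x => (h x - h o) ^ 2 + (2 * h o * h x - h o ^ 2) := by
    ext x; ring
  have hi2 : Integrable (fun x => 2 * h o * h x - h o ^ 2) μ :=
    (hi.const_mul _).sub (integrable_const _)
  have hsq : Integrable (fun x => h x ^ 2) μ := by
    rw [hexp]; exact hiw.add hi2
  rw [← ofReal_integral_eq_lintegral_ofReal (f := fun x => h x ^ 2 + k * V)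
    (hsq.add (integrable_const _)) (.of_forall fun x => by positivity)]
  refine ENNReal.ofReal_le_ofReal ?_
  have e1 : ∫ x, (h x ^ 2 + k * V) ∂μ = ∫ x, h x ^ 2 ∂μ + k * V := by
    rw [integral_add hsq (integrable_const _)]; simp
  rw [e1, hexp, integral_add hiw hi2, integral_sub (hi.const_mul _) (integrable_const _),
    integral_const_mul]
  have e2 : ∫ x, (h x - h o) ^ 2 ∂μ ≤ V := by
    rw [hV, ← integral_const_mul]
    exact integral_mono hiw (ho.const_mul _) hsub
  simp only [integral_const, probReal_univ, smul_eq_mul, one_mul]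
  push_cast
  nlinarith [sq_nonneg ((∫ x, h x ∂μ) - h o)]

/-- Tensorization of an exponential moment bound. -/
theorem lintegral_exp_pi_le (μ : Measure E) [IsProbabilityMeasure μ] {c K : ℝ}
    (hc : 0 ≤ c) (o : E) (ho : Integrable (fun x => dist x o) μ)
    (hμ : ∀ h : E → ℝ, (∀ x y, |h x - h y| ≤ c * dist x y) →
      ∫⁻ x, ENNReal.ofReal (Real.exp (h x)) ∂μ ≤ ENNReal.ofReal (Real.exp (∫ x, h x ∂μ + K)))
    (n : ℕ) (g : (Fin n → E) → ℝ) (hg : CoordLipschitz c g) :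
    ∫⁻ x, ENNReal.ofReal (Real.exp (g x)) ∂(Measure.pi fun _ : Fin n => μ) ≤
      ENNReal.ofReal (Real.exp (∫ x, g x ∂(Measure.pi fun _ : Fin n => μ) + n * K)) := by
  have h := lintegral_pi_le_of_lintegral_le μ hc o ho
    (fun k u => ENNReal.ofReal (Real.exp (u + k * K))) (fun k => by fun_prop) ?_ n 0 g hg
  · simpa using h
  intro k h hh
  simp only [Real.exp_add, Nat.cast_add, add_mul, Nat.cast_one, one_mul]
  have h0 := hμ h hh
  rw [Real.exp_add] at h0
  simp_rw [ENNReal.ofReal_mul (Real.exp_pos _).le] at h0 ⊢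
  rw [lintegral_mul_const' _ _ ENNReal.ofReal_ne_top, mul_comm (ENNReal.ofReal (Real.exp (k * K))),
    ← mul_assoc]
  gcongr

end Tensor

/-! ### The transport inequality and exponential moments of Lipschitz functions -/

section Transport

variable {E : Type*} [PseudoMetricSpace E] [MeasurableSpace E] [BorelSpace E]

/-- The easy half of Kantorovich duality: every coupling bounds the difference of the integrals.
Boundedness of `h` makes it integrable under every coupling. -/
lemma ofReal_integral_sub_le_wasserstein₁ {c B : ℝ} (h : E → ℝ)
    (hh : ∀ x y, |h x - h y| ≤ c * dist x y) (hB : ∀ x, |h x| ≤ B) (μ ν : Measure E)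
    [IsProbabilityMeasure μ] (hW : wasserstein₁ μ ν ≠ ∞) :
    ENNReal.ofReal (∫ x, h x ∂ν - ∫ x, h x ∂μ) ≤ wasserstein₁ μ ν * ENNReal.ofReal c := by
  have hcont : Continuous h := (LipschitzWith.of_dist_le' (K := c) fun x y => by
    rw [Real.dist_eq]; exact hh x y).continuous
  rw [← ENNReal.div_le_iff_le_mul (Or.inr hW) (Or.inl ENNReal.ofReal_ne_top)]
  refine le_iInf₂ fun γ hγ => ENNReal.div_le_of_le_mul ?_
  obtain ⟨h1, h2⟩ := hγ
  have hγp : IsProbabilityMeasure γ := by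
    refine ⟨?_⟩
    have := measure_univ (μ := μ)
    rwa [← h1, Measure.map_apply measurable_fst MeasurableSet.univ, Set.preimage_univ] at this
  have hi1 : Integrable (fun z : E × E => h z.1) γ :=
    Integrable.of_bound (hcont.measurable.comp measurable_fst).aestronglyMeasurable B
      (.of_forall fun z => hB z.1)
  have hi2 : Integrable (fun z : E × E => h z.2) γ :=
    Integrable.of_bound (hcont.measurable.comp measurable_snd).aestronglyMeasurable B
      (.of_forall fun z => hB z.2)
  have e1 : ∫ x, h x ∂μ = ∫ z, h z.1 ∂γ := by
    rw [← h1, integral_map measurable_fst.aemeasurable hcont.measurable.aestronglyMeasurable]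
  have e2 : ∫ x, h x ∂ν = ∫ z, h z.2 ∂γ := by
    rw [← h2, integral_map measurable_snd.aemeasurable hcont.measurable.aestronglyMeasurable]
  rw [e1, e2, ← integral_sub hi2 hi1, ← lintegral_mul_const' _ _ ENNReal.ofReal_ne_top]
  refine (Real.ofReal_le_enorm _).trans ((enorm_integral_le_lintegral_enorm _).trans ?_)
  refine lintegral_mono fun z => ?_
  rw [Real.enorm_eq_ofReal_abs, edist_dist, ← ENNReal.ofReal_mul dist_nonneg]
  refine ENNReal.ofReal_le_ofReal ((hh _ _).trans_eq ?_)
  rw [dist_comm, mul_comm]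

/-- Gibbs' variational identity: for the tilt ν of μ by h, the entropy H(ν | μ) equals ∫ h dν - log
∫ exp h dμ. Thus log ∫ exp h dμ - ∫ h dμ ≤ c W₁ - H, and T₁ bounds this by maximizing over W₁. -/
lemma integral_exp_le_of_transport_of_bounded {c B κ : ℝ} (hc : 0 ≤ c) (hκ : 0 < κ) (h : E → ℝ)
    (hh : ∀ x y, |h x - h y| ≤ c * dist x y) (hB : ∀ x, |h x| ≤ B) (μ : Measure E)
    [IsProbabilityMeasure μ] (hT : TransportInequality₁ μ κ) :
    ∫⁻ x, ENNReal.ofReal (Real.exp (h x)) ∂μ ≤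
      ENNReal.ofReal (Real.exp (∫ x, h x ∂μ + c ^ 2 * κ ^ 2 / 2)) := by
  have hcont : Continuous h := (LipschitzWith.of_dist_le' (K := c) fun x y => by
    rw [Real.dist_eq]; exact hh x y).continuous
  have hei : Integrable (fun x => Real.exp (h x)) μ :=
    Integrable.of_bound (Real.continuous_exp.comp hcont).measurable.aestronglyMeasurable
      (Real.exp B) (.of_forall fun x => by
        rw [Real.norm_eq_abs, Real.abs_exp]
        exact Real.exp_le_exp.2 ((le_abs_self _).trans (hB x)))
  set ν := μ.tilted h with hν
  have hνp : IsProbabilityMeasure ν := isProbabilityMeasure_tilted hei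
  have hac : ν ≪ μ := tilted_absolutelyContinuous μ h
  have hZ : 0 < ∫ x, Real.exp (h x) ∂μ := integral_exp_pos hei
  have hllr : llr ν μ =ᵐ[ν] fun x => h x - Real.log (∫ x, Real.exp (h x) ∂μ) :=
    hac.ae_le (log_rnDeriv_tilted_left_self hei)
  have hiν : Integrable h ν :=
    Integrable.of_bound hcont.measurable.aestronglyMeasurable B (.of_forall hB)
  have hllri : Integrable (llr ν μ) ν :=
    (integrable_congr hllr).2 (hiν.sub (integrable_const _))
  have hfin := InformationTheory.klDiv_ne_top hac hllri
  have hH : (InformationTheory.klDiv ν μ).toReal =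
      ∫ x, h x ∂ν - Real.log (∫ x, Real.exp (h x) ∂μ) := by
    rw [InformationTheory.toReal_klDiv_of_measure_eq hac (by simp), integral_congr_ae hllr,
      integral_sub hiν (integrable_const _)]
    simp
  have hTν := hT ν hνp hac
  have hrhs : ENNReal.ofReal (2 * κ ^ 2) * InformationTheory.klDiv ν μ ≠ ∞ :=
    ENNReal.mul_ne_top ENNReal.ofReal_ne_top hfin
  have hW : wasserstein₁ μ ν ≠ ∞ := by
    intro h0
    rw [h0] at hTν
    exact hrhs (top_le_iff.1 (by simpa using hTν))
  set w := (wasserstein₁ μ ν).toReal with hw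
  set H := (InformationTheory.klDiv ν μ).toReal with hHd
  have hwH : w ^ 2 ≤ 2 * κ ^ 2 * H := by
    have := ENNReal.toReal_mono hrhs hTν
    rwa [ENNReal.toReal_pow, ENNReal.toReal_mul, ENNReal.toReal_ofReal (by positivity)] at this
  have hD : ∫ x, h x ∂ν - ∫ x, h x ∂μ ≤ w * c := by
    have h1 := ofReal_integral_sub_le_wasserstein₁ h hh hB μ ν hW
    rw [← ENNReal.ofReal_toReal hW, ← ENNReal.ofReal_mul ENNReal.toReal_nonneg] at h1
    exact (ENNReal.ofReal_le_ofReal_iff (mul_nonneg ENNReal.toReal_nonneg hc)).1 h1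
  -- Young's inequality, multiplied by κ²: since κ² H ≥ w²/2, the claim reduces to (c κ² - w)² ≥ 0.
  have hyoung : w * c - H ≤ c ^ 2 * κ ^ 2 / 2 := by
    have hk : 0 < κ ^ 2 := by positivity
    have : κ ^ 2 * (w * c - H) ≤ κ ^ 2 * (c ^ 2 * κ ^ 2 / 2) := by
      nlinarith [sq_nonneg (c * κ ^ 2 - w)]
    exact le_of_mul_le_mul_left this hk
  rw [← ofReal_integral_eq_lintegral_ofReal hei (.of_forall fun x => (Real.exp_pos _).le)]
  refine ENNReal.ofReal_le_ofReal ?_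
  rw [← Real.log_le_iff_le_exp hZ]
  linarith

/-- The easy direction of the Bobkov–Götze theorem. -/
theorem integral_exp_le_of_transport {c κ : ℝ} (hc : 0 ≤ c) (hκ : 0 < κ) (h : E → ℝ)
    (hh : ∀ x y, |h x - h y| ≤ c * dist x y) (μ : Measure E)
    [IsProbabilityMeasure μ] (hi : Integrable h μ) (hT : TransportInequality₁ μ κ) :
    ∫⁻ x, ENNReal.ofReal (Real.exp (h x)) ∂μ ≤
      ENNReal.ofReal (Real.exp (∫ x, h x ∂μ + c ^ 2 * κ ^ 2 / 2)) := by
  have hcont : Continuous h := (LipschitzWith.of_dist_le' (K := c) fun x y => by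
    rw [Real.dist_eq]; exact hh x y).continuous
  -- Truncation at level N keeps the Lipschitz constant. The means converge by domination, the
  -- exponential moments are controlled by Fatou's lemma.
  set t : ℕ → E → ℝ := fun N x => max (min (h x) N) (-N) with ht
  have htc : ∀ N, Continuous (t N) := fun N => by simp only [ht]; fun_prop
  have htlip : ∀ N x y, |t N x - t N y| ≤ c * dist x y := fun N x y =>
    ((abs_max_sub_max_le_abs _ _ _).trans (abs_min_sub_min_le_max _ _ _ _)).trans (by
      simpa using hh x y)
  have htb : ∀ N x, |t N x| ≤ N := fun N x => by
    have : (0 : ℝ) ≤ N := Nat.cast_nonneg N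
    exact abs_le.2 ⟨le_max_right _ _, max_le (min_le_right _ _) (by linarith)⟩
  have hta : ∀ N x, |t N x| ≤ |h x| := fun N x => by
    have h0 : (0 : ℝ) ≤ N := Nat.cast_nonneg N
    refine abs_le.2 ⟨?_, ?_⟩
    · refine le_max_of_le_left (le_min (neg_abs_le _) ?_)
      linarith [abs_nonneg (h x)]
    · exact max_le ((min_le_left _ _).trans (le_abs_self _)) (by linarith [abs_nonneg (h x)])
  have hlim : ∀ x, Tendsto (fun N => t N x) atTop (nhds (h x)) := fun x => by
    refine tendsto_const_nhds.congr' ?_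
    filter_upwards [eventually_ge_atTop ⌈|h x|⌉₊] with N hN
    have : |h x| ≤ N := Nat.ceil_le.1 hN
    simp only [ht]
    rw [min_eq_left ((le_abs_self _).trans this), max_eq_left (by linarith [neg_abs_le (h x)])]
  have hint : Tendsto (fun N => ∫ x, t N x ∂μ) atTop (nhds (∫ x, h x ∂μ)) :=
    tendsto_integral_of_dominated_convergence (fun x => |h x|)
      (fun N => (htc N).measurable.aestronglyMeasurable) hi.abs
      (fun N => .of_forall fun x => hta N x) (.of_forall hlim)
  have hR : Tendsto (fun N => ENNReal.ofReal (Real.exp (∫ x, t N x ∂μ + c ^ 2 * κ ^ 2 / 2)))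
      atTop (nhds (ENNReal.ofReal (Real.exp (∫ x, h x ∂μ + c ^ 2 * κ ^ 2 / 2)))) :=
    ENNReal.tendsto_ofReal ((Real.continuous_exp.tendsto _).comp (hint.add_const _))
  calc ∫⁻ x, ENNReal.ofReal (Real.exp (h x)) ∂μ
      = ∫⁻ x, liminf (fun N => ENNReal.ofReal (Real.exp (t N x))) atTop ∂μ := by
        refine lintegral_congr fun x => (Tendsto.liminf_eq ?_).symm
        exact ENNReal.tendsto_ofReal ((Real.continuous_exp.tendsto _).comp (hlim x))
    _ ≤ liminf (fun N => ∫⁻ x, ENNReal.ofReal (Real.exp (t N x)) ∂μ) atTop :=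
        lintegral_liminf_le fun N => (Real.continuous_exp.comp (htc N)).measurable.ennreal_ofReal
    _ ≤ liminf (fun N => ENNReal.ofReal (Real.exp (∫ x, t N x ∂μ + c ^ 2 * κ ^ 2 / 2))) atTop :=
        liminf_le_liminf (.of_forall fun N =>
          integral_exp_le_of_transport_of_bounded hc hκ (t N) (htlip N) (htb N) μ hT)
    _ = _ := hR.liminf_eq

end Transport

/-! ### Basic properties of the test functions and of the discrepancy of paths -/

section Basic

variable {d : ℕ} {T : ℝ}

lemma iSup_norm_sq_eq (hT : 0 < T) (x : PathSpace d T) : (⨆ t, ‖x t‖ ^ 2) = ‖x‖ ^ 2 := by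
  have : Nonempty (Set.Icc (0 : ℝ) T) := ⟨⟨0, le_rfl, hT.le⟩⟩
  have hle : ∀ t, ‖x t‖ ^ 2 ≤ ‖x‖ ^ 2 := fun t =>
    pow_le_pow_left₀ (norm_nonneg _) (x.norm_coe_le_norm t) 2
  have hbdd : BddAbove (Set.range fun t => ‖x t‖ ^ 2) := ⟨_, by rintro _ ⟨t, rfl⟩; exact hle t⟩
  refine le_antisymm (ciSup_le hle) ?_
  have h0 : 0 ≤ ⨆ t, ‖x t‖ ^ 2 := Real.iSup_nonneg fun t => sq_nonneg _
  rw [← Real.le_sqrt (norm_nonneg _) h0, ContinuousMap.norm_le _ (Real.sqrt_nonneg _)]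
  exact fun t => Real.le_sqrt_of_sq_le (le_ciSup hbdd t)

lemma FunctionClass.continuous {Φ : Set (Eucl d → ℝ)} {A₁ A₂ A₃ : ℝ}
    (hΦ : FunctionClass Φ A₁ A₂ A₃) {f : Eucl d → ℝ} (hf : f ∈ Φ) : Continuous f :=
  (LipschitzWith.of_dist_le' (K := A₁) fun x y => by
    rw [Real.dist_eq, dist_eq_norm]; exact hΦ.lipschitz f hf x y).continuous

lemma FunctionClass.abs_le {Φ : Set (Eucl d → ℝ)} {A₁ A₂ A₃ : ℝ}
    (hΦ : FunctionClass Φ A₁ A₂ A₃) {f : Eucl d → ℝ} (hf : f ∈ Φ) (x : Eucl d) :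
    |f x| ≤ max A₁ A₂ * (‖x‖ + 1) := by
  have h1 := hΦ.lipschitz f hf x 0
  have h2 := hΦ.bound_zero f hf
  have h3 := abs_sub_abs_le_abs_sub (f x) (f 0)
  rw [sub_zero] at h1
  have h4 : A₁ * ‖x‖ ≤ max A₁ A₂ * ‖x‖ :=
    mul_le_mul_of_nonneg_right (le_max_left _ _) (norm_nonneg _)
  have h5 := le_max_right A₁ A₂
  linarith

lemma FunctionClass.max_pos {Φ : Set (Eucl d → ℝ)} {A₁ A₂ A₃ : ℝ}
    (hΦ : FunctionClass Φ A₁ A₂ A₃) : 0 < max A₁ A₂ := lt_max_of_lt_left hΦ.A₁_pos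

lemma integrable_norm_of_sq (μ : Measure (PathSpace d T)) [IsFiniteMeasure μ]
    (hμ : Integrable (fun x => ‖x‖ ^ 2) μ) : Integrable (fun x => ‖x‖) μ := by
  refine (hμ.add (integrable_const (1 : ℝ))).mono' (by fun_prop) (.of_forall fun x => ?_)
  simp only [norm_norm, Pi.add_apply]
  nlinarith [sq_nonneg (‖x‖ - 1)]

lemma FunctionClass.integrable_eval {Φ : Set (Eucl d → ℝ)} {A₁ A₂ A₃ : ℝ}
    (hΦ : FunctionClass Φ A₁ A₂ A₃) {f : Eucl d → ℝ} (hf : f ∈ Φ)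
    (μ : Measure (PathSpace d T)) [IsFiniteMeasure μ] (hμ : Integrable (fun x => ‖x‖) μ)
    (t : Set.Icc (0 : ℝ) T) : Integrable (fun x : PathSpace d T => f (x t)) μ := by
  refine ((hμ.add (integrable_const (1 : ℝ))).const_mul (max A₁ A₂)).mono'
    ((hΦ.continuous hf).comp (continuous_eval_const t)).measurable.aestronglyMeasurable
    (.of_forall fun x => ?_)
  rw [Real.norm_eq_abs]
  refine (hΦ.abs_le hf _).trans (mul_le_mul_of_nonneg_left ?_ hΦ.max_pos.le)
  simp only [Pi.add_apply]
  linarith [x.norm_coe_le_norm t]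

/-- The uniform-in-time discrepancy between a law on path space and an empirical measure. -/
def pathGmmd {n : ℕ} (Φ : Set (Eucl d → ℝ)) (μ : Measure (PathSpace d T))
    (x : Fin n → PathSpace d T) : ℝ≥0∞ :=
  ⨆ t, gmmd Φ (marginal μ t) (empirical fun i => x i t)

variable {Φ : Set (Eucl d → ℝ)} {A₁ A₂ A₃ : ℝ} {n : ℕ}

lemma pathGmmd_eq (hΦ : FunctionClass Φ A₁ A₂ A₃) (μ : Measure (PathSpace d T))
    (x : Fin n → PathSpace d T) :
    pathGmmd Φ μ x =
      ⨆ t, ⨆ f ∈ Φ, ‖∫ y, f (y t) ∂μ - (n : ℝ)⁻¹ * ∑ i, f (x i t)‖ₑ := by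
  refine iSup_congr fun t => biSup_congr fun f hf => ?_
  have h1 : ∫ y, f y ∂(marginal μ t) = ∫ y, f (y t) ∂μ :=
    integral_map (continuous_eval_const t).measurable.aemeasurable
      (hΦ.continuous hf).measurable.aestronglyMeasurable
  have h2 : ∫ y, f y ∂(empirical fun i => x i t) = (n : ℝ)⁻¹ * ∑ i, f (x i t) := by
    rw [empirical, integral_smul_measure, integral_finsetSum_measure]
    · simp [integral_dirac]
    · exact fun i _ => integrable_dirac (by simp)
  rw [h1, h2]

/-- The supremum over t and f may be uncountable, but a supremum of continuous functions of the
sample is lower semicontinuous, hence Borel. -/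
lemma measurable_pathGmmd (hΦ : FunctionClass Φ A₁ A₂ A₃)
    (μ : Measure (PathSpace d T)) :
    Measurable (pathGmmd Φ μ : (Fin n → PathSpace d T) → ℝ≥0∞) := by
  rw [show (pathGmmd Φ μ : (Fin n → PathSpace d T) → ℝ≥0∞) = _ from
    funext fun x => pathGmmd_eq hΦ μ x]
  refine LowerSemicontinuous.measurable (lowerSemicontinuous_iSup fun t =>
    lowerSemicontinuous_biSup fun f hf => Continuous.lowerSemicontinuous ?_)
  have := hΦ.continuous hf
  refine continuous_enorm.comp (continuous_const.sub (continuous_const.mul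
    (continuous_finsetSum _ fun i _ => this.comp ?_)))
  exact (continuous_eval_const t).comp (continuous_apply i)

lemma enorm_le_enorm_add_ofReal {a b c : ℝ} (h : |a - b| ≤ c) :
    ‖a‖ₑ ≤ ‖b‖ₑ + ENNReal.ofReal c := by
  have h1 : ‖a‖ₑ ≤ ‖b‖ₑ + ‖a - b‖ₑ := by
    simpa using enorm_add_le b (a - b)
  refine h1.trans (add_le_add le_rfl ?_)
  rw [Real.enorm_eq_ofReal_abs]
  exact ENNReal.ofReal_le_ofReal h

/-- Replacing one path moves every empirical mean, at every time, by at most A₁/n times the uniform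
distance. The additive form in `ℝ≥0∞` does not presuppose finiteness, which is deduced from it. -/
lemma pathGmmd_le_add (hΦ : FunctionClass Φ A₁ A₂ A₃) (μ : Measure (PathSpace d T))
    (x y : Fin n → PathSpace d T) :
    pathGmmd Φ μ x ≤ pathGmmd Φ μ y + ENNReal.ofReal (A₁ / n * ∑ i, dist (x i) (y i)) := by
  rw [pathGmmd_eq hΦ, pathGmmd_eq hΦ]
  refine iSup_le fun t => iSup₂_le fun f hf => ?_
  refine (enorm_le_enorm_add_ofReal (b := ∫ y, f (y t) ∂μ - (n : ℝ)⁻¹ * ∑ i, f (y i t)) ?_).trans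
    (add_le_add (le_iSup_of_le t (le_iSup₂_of_le f hf le_rfl)) le_rfl)
  have : ∫ y, f (y t) ∂μ - (n : ℝ)⁻¹ * ∑ i, f (x i t) -
      (∫ y, f (y t) ∂μ - (n : ℝ)⁻¹ * ∑ i, f (y i t)) =
      (n : ℝ)⁻¹ * ∑ i, (f (y i t) - f (x i t)) := by
    rw [Finset.sum_sub_distrib]; ring
  rw [this, abs_mul, abs_of_nonneg (by positivity : (0 : ℝ) ≤ (n : ℝ)⁻¹), div_eq_inv_mul,
    mul_assoc, Finset.mul_sum _ _ A₁]
  refine mul_le_mul_of_nonneg_left ((Finset.abs_sum_le_sum_abs _ _).trans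
    (Finset.sum_le_sum fun i _ => ?_)) (by positivity)
  refine (hΦ.lipschitz f hf _ _).trans (mul_le_mul_of_nonneg_left ?_ hΦ.A₁_pos.le)
  rw [← dist_eq_norm, dist_comm]
  exact ContinuousMap.dist_apply_le_dist t

/-- For the sample of zero paths the constants f(0) cancel and A₁ ∫ ‖x‖ dμ is a bound;
`pathGmmd_le_add` carries finiteness to every sample. -/
lemma pathGmmd_ne_top (hΦ : FunctionClass Φ A₁ A₂ A₃) (hn : 0 < n) (μ : Measure (PathSpace d T))
    [IsProbabilityMeasure μ] (hμ : Integrable (fun x => ‖x‖) μ) (x : Fin n → PathSpace d T) :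
    pathGmmd Φ μ x ≠ ∞ := by
  have h0 : pathGmmd Φ μ (fun _ : Fin n => (0 : PathSpace d T)) ≤
      ENNReal.ofReal (A₁ * ∫ x, ‖x‖ ∂μ) := by
    rw [pathGmmd_eq hΦ]
    refine iSup_le fun t => iSup₂_le fun f hf => ?_
    rw [Real.enorm_eq_ofReal_abs]
    refine ENNReal.ofReal_le_ofReal ?_
    have hn' : (n : ℝ) ≠ 0 := by positivity
    have h1 : (n : ℝ)⁻¹ * ∑ _i : Fin n, f ((0 : PathSpace d T) t) = ∫ _y, f 0 ∂μ := by
      simp [hn']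
    rw [h1, ← integral_sub (hΦ.integrable_eval hf μ hμ t) (integrable_const _),
      ← integral_const_mul, ← Real.norm_eq_abs]
    refine norm_integral_le_of_norm_le (hμ.const_mul A₁) (.of_forall fun y => ?_)
    refine (hΦ.lipschitz f hf _ _).trans (mul_le_mul_of_nonneg_left ?_ hΦ.A₁_pos.le)
    rw [sub_zero]
    exact y.norm_coe_le_norm t
  exact ((pathGmmd_le_add hΦ μ x _).trans_lt (ENNReal.add_lt_top.2
    ⟨h0.trans_lt ENNReal.ofReal_lt_top, ENNReal.ofReal_lt_top⟩)).ne

lemma toReal_le_toReal_add {a b : ℝ≥0∞} {c : ℝ} (hb : b ≠ ∞) (hc : 0 ≤ c)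
    (h : a ≤ b + ENNReal.ofReal c) : a.toReal ≤ b.toReal + c := by
  have := ENNReal.toReal_mono (ENNReal.add_ne_top.2 ⟨hb, ENNReal.ofReal_ne_top⟩) h
  rwa [ENNReal.toReal_add hb ENNReal.ofReal_ne_top, ENNReal.toReal_ofReal hc] at this

lemma coordLipschitz_pathGmmd (hΦ : FunctionClass Φ A₁ A₂ A₃) (hn : 0 < n)
    (μ : Measure (PathSpace d T)) [IsProbabilityMeasure μ] (hμ : Integrable (fun x => ‖x‖) μ) :
    CoordLipschitz (A₁ / n) fun x : Fin n → PathSpace d T => (pathGmmd Φ μ x).toReal := by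
  have hA := hΦ.A₁_pos
  have key : ∀ x y : Fin n → PathSpace d T, (pathGmmd Φ μ x).toReal ≤
      (pathGmmd Φ μ y).toReal + A₁ / n * ∑ i, dist (x i) (y i) := fun x y =>
    toReal_le_toReal_add (pathGmmd_ne_top hΦ hn μ hμ y)
      (mul_nonneg (by positivity) (Finset.sum_nonneg fun i _ => dist_nonneg))
      (pathGmmd_le_add hΦ μ x y)
  intro x y
  have h1 := key x y
  have h2 := key y x
  simp only [dist_comm (y _)] at h2
  exact abs_le.2 ⟨by linarith, by linarith⟩

end Basic

/-! ### Rademacher averages, uniformly in time, for fixed paths -/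

section Rademacher

variable {d : ℕ} {T : ℝ} {Φ : Set (Eucl d → ℝ)} {A₁ A₂ A₃ : ℝ} {n : ℕ}

/-- The supremum over the test functions of a signed sum at a fixed time. -/
def signedSup (Φ : Set (Eucl d → ℝ)) (x : Fin n → PathSpace d T) (t : Set.Icc (0 : ℝ) T)
    (ξ : Fin n → ℤˣ) : ℝ≥0∞ :=
  ⨆ f ∈ Φ, ‖∑ i, ((ξ i : ℤ) : ℝ) * f (x i t)‖ₑ

lemma abs_sign (u : ℤˣ) : |((u : ℤ) : ℝ)| = 1 := by
  rcases Int.units_eq_one_or u with h | h <;> simp [h]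

lemma signedSup_ne_top (hΦ : FunctionClass Φ A₁ A₂ A₃) (x : Fin n → PathSpace d T)
    (t : Set.Icc (0 : ℝ) T) (ξ : Fin n → ℤˣ) : signedSup Φ x t ξ ≠ ∞ := by
  refine ((iSup₂_le fun f hf => ?_ : signedSup Φ x t ξ ≤
    ENNReal.ofReal (∑ i, max A₁ A₂ * (‖x i t‖ + 1))).trans_lt ENNReal.ofReal_lt_top).ne
  rw [Real.enorm_eq_ofReal_abs]
  refine ENNReal.ofReal_le_ofReal ((Finset.abs_sum_le_sum_abs _ _).trans
    (Finset.sum_le_sum fun i _ => ?_))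
  rw [abs_mul, abs_sign, one_mul]
  exact hΦ.abs_le hf _

/-- The weights involve the uniform norm of the paths rather than their values at `t`, so that the
same ones serve all grid times. -/
lemma signedSup_sub_le (hΦ : FunctionClass Φ A₁ A₂ A₃) (x : Fin n → PathSpace d T)
    (t : Set.Icc (0 : ℝ) T) (ξ η : Fin n → ℤˣ) :
    |(signedSup Φ x t ξ).toReal - (signedSup Φ x t η).toReal| ≤
      ∑ i, |((ξ i : ℤ) : ℝ) - ((η i : ℤ) : ℝ)| * (max A₁ A₂ * (‖x i‖ + 1)) := by
  have hm := hΦ.max_pos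
  have key : ∀ ξ η : Fin n → ℤˣ, (signedSup Φ x t ξ).toReal ≤ (signedSup Φ x t η).toReal +
      ∑ i, |((ξ i : ℤ) : ℝ) - ((η i : ℤ) : ℝ)| * (max A₁ A₂ * (‖x i‖ + 1)) := by
    intro ξ η
    refine toReal_le_toReal_add (signedSup_ne_top hΦ x t η)
      (Finset.sum_nonneg fun i _ => by positivity) (iSup₂_le fun f hf => ?_)
    refine (enorm_le_enorm_add_ofReal (b := ∑ i, ((η i : ℤ) : ℝ) * f (x i t)) ?_).trans
      (add_le_add (le_iSup₂_of_le f hf le_rfl) le_rfl)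
    rw [← Finset.sum_sub_distrib]
    refine (Finset.abs_sum_le_sum_abs _ _).trans (Finset.sum_le_sum fun i _ => ?_)
    rw [← sub_mul, abs_mul]
    refine mul_le_mul_of_nonneg_left ((hΦ.abs_le hf _).trans ?_) (abs_nonneg _)
    gcongr
    exact (x i).norm_coe_le_norm t
  have h1 := key ξ η
  have h2 := key η ξ
  simp only [abs_sub_comm ((η _ : ℤ) : ℝ)] at h2
  exact abs_le.2 ⟨by linarith, by linarith⟩

lemma average_signedSup_le (hΦ : FunctionClass Φ A₁ A₂ A₃) (hn : 0 < n)
    (x : Fin n → PathSpace d T) (t : Set.Icc (0 : ℝ) T) :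
    (2 ^ n : ℝ)⁻¹ * ∑ ξ, (signedSup Φ x t ξ).toReal ≤ A₃ * √(∑ i, (‖x i‖ ^ 2 + 1)) := by
  have hA := hΦ.A₃_pos
  have h := hΦ.rademacher n hn fun i => x i t
  have h' : (rademacherComplexity Φ fun i => x i t) =
      (n : ℝ≥0∞)⁻¹ * ((2 ^ n : ℝ≥0∞)⁻¹ * ∑ ξ, signedSup Φ x t ξ) := rfl
  rw [h'] at h
  have h2 := ENNReal.toReal_mono ENNReal.ofReal_ne_top h
  rw [ENNReal.toReal_ofReal (by positivity), ENNReal.toReal_mul, ENNReal.toReal_mul,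
    ENNReal.toReal_sum fun ξ _ => signedSup_ne_top hΦ x t ξ] at h2
  simp only [ENNReal.toReal_inv, ENNReal.toReal_natCast, ENNReal.toReal_pow,
    ENNReal.toReal_ofNat] at h2
  have hn' : (0 : ℝ) < n := by positivity
  rw [inv_mul_le_iff₀ hn'] at h2
  refine h2.trans ?_
  have e : (n : ℝ) * (A₃ / n * √(∑ i, (‖x i t‖ ^ 2 + 1))) = A₃ * √(∑ i, (‖x i t‖ ^ 2 + 1)) := by
    field_simp
  rw [e]
  gcongr with i
  exact (x i).norm_coe_le_norm t

/-- The points `j T / k`, `j < k`, form a net of mesh `T / k` of `[0, T]`. -/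
lemma exists_grid (hT : 0 < T) {k : ℕ} (hk : 0 < k) :
    ∃ s : Fin k → Set.Icc (0 : ℝ) T, ∀ t : Set.Icc (0 : ℝ) T, ∃ j, |(t : ℝ) - s j| ≤ T / k := by
  have hk' : (0 : ℝ) < k := by positivity
  refine ⟨fun j => ⟨j * T / k, by positivity, ?_⟩, fun t => ?_⟩
  · rw [div_le_iff₀ hk', mul_comm T]
    exact mul_le_mul_of_nonneg_right (by exact_mod_cast j.2.le) hT.le
  · obtain ⟨t, ht0, htT⟩ := t
    -- The floor rule would give the endpoint T the index k, outside the grid; it is served by k -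
    -- 1, at distance exactly T / k.
    by_cases htk : t = T
    · refine ⟨⟨k - 1, by omega⟩, ?_⟩
      simp only [htk]
      rw [Nat.cast_sub hk, Nat.cast_one, show T - (k - 1 : ℝ) * T / k = T / k by field_simp; ring,
        abs_of_nonneg (by positivity)]
    · have htT' : t < T := lt_of_le_of_ne htT htk
      have hfl : ⌊t * k / T⌋₊ < k := by
        rw [Nat.floor_lt (by positivity), div_lt_iff₀ hT, mul_comm]
        exact mul_lt_mul_of_pos_left htT' hk'
      refine ⟨⟨⌊t * k / T⌋₊, hfl⟩, ?_⟩
      have h1 := Nat.floor_le (by positivity : 0 ≤ t * k / T)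
      have h2 := Nat.lt_floor_add_one (t * k / T)
      simp only
      set q : ℝ := (⌊t * k / T⌋₊ : ℝ)
      rw [le_div_iff₀ hT] at h1
      rw [div_lt_iff₀ hT] at h2
      rw [abs_le]
      constructor
      · have h3 : q * T / k ≤ t := by rw [div_le_iff₀ hk']; exact h1
        have h4 : 0 ≤ T / k := by positivity
        linarith
      · rw [sub_le_iff_le_add, ← add_div, le_div_iff₀ hk']
        linarith

lemma signedSup_le_add_modulus (hΦ : FunctionClass Φ A₁ A₂ A₃) (x : Fin n → PathSpace d T)
    (t s : Set.Icc (0 : ℝ) T) {h : ℝ} (hts : |(t : ℝ) - s| ≤ h) (ξ : Fin n → ℤˣ) :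
    signedSup Φ x t ξ ≤ signedSup Φ x s ξ + ENNReal.ofReal A₁ * ∑ i, modulus (x i) h := by
  refine iSup₂_le fun f hf => ?_
  refine (enorm_le_enorm_add_ofReal (b := ∑ i, ((ξ i : ℤ) : ℝ) * f (x i s))
    (c := A₁ * ∑ i, ‖x i t - x i s‖) ?_).trans
      (add_le_add (le_iSup₂_of_le f hf le_rfl) ?_)
  · rw [← Finset.sum_sub_distrib, Finset.mul_sum]
    refine (Finset.abs_sum_le_sum_abs _ _).trans (Finset.sum_le_sum fun i _ => ?_)
    rw [← mul_sub, abs_mul, abs_sign, one_mul]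
    exact hΦ.lipschitz f hf _ _
  · rw [ENNReal.ofReal_mul hΦ.A₁_pos.le, ENNReal.ofReal_sum_of_nonneg fun i _ => norm_nonneg _]
    gcongr with i
    rw [ofReal_norm]
    exact le_iSup_of_le t (le_iSup_of_le s (le_iSup_of_le hts le_rfl))

/-- The average over signs of the supremum over all times, for fixed paths. -/
theorem average_iSup_signedSup_le (hΦ : FunctionClass Φ A₁ A₂ A₃) (hT : 0 < T) (hn : 0 < n)
    (x : Fin n → PathSpace d T) {k : ℕ} (hk : 0 < k) {h L : ℝ} (hh : T / k ≤ h) (hL : 0 < L)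
    (hkL : Real.log k ≤ L) :
    (2 ^ n : ℝ≥0∞)⁻¹ * ∑ ξ : Fin n → ℤˣ, ⨆ t, signedSup Φ x t ξ ≤
      ENNReal.ofReal ((A₃ + 2 * max A₁ A₂ * √L) * √(∑ i, (‖x i‖ ^ 2 + 1))) +
        ENNReal.ofReal A₁ * ∑ i, modulus (x i) h := by
  have hm := hΦ.max_pos
  set m := max A₁ A₂ with hmd
  set S := √(∑ i, (‖x i‖ ^ 2 + 1)) with hS
  have hSpos : 0 < S := by
    refine Real.sqrt_pos.2 (Finset.sum_pos (fun i _ => by positivity) ?_)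
    exact ⟨⟨0, hn⟩, Finset.mem_univ _⟩
  have hS2 : S ^ 2 = ∑ i, (‖x i‖ ^ 2 + 1) :=
    Real.sq_sqrt (Finset.sum_nonneg fun i _ => by positivity)
  have hsL : 0 < √L := Real.sqrt_pos.2 hL
  have : Nonempty (Fin k) := ⟨⟨0, hk⟩⟩
  obtain ⟨s, hs⟩ := exists_grid hT hk
  set u : (Fin n → ℤˣ) → ℝ := fun ξ =>
    Finset.univ.sup' Finset.univ_nonempty fun j => (signedSup Φ x (s j) ξ).toReal with hu
  have hmain : (2 ^ n : ℝ)⁻¹ * ∑ ξ, u ξ ≤ (A₃ + 2 * m * √L) * S := by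
    -- The proxy 2 m² S² comes from (‖x‖ + 1)² ≤ 2 (‖x‖² + 1). The choice lam = √L / (m S) balances
    -- the two error terms, each then being at most √L m S.
    have h1 := sign_average_sup_le (fun j ξ => (signedSup Φ x (s j) ξ).toReal)
      (fun i => m * (‖x i‖ + 1)) (A₃ * S) (√L / (m * S)) (2 * m ^ 2 * S ^ 2) (by positivity)
      (by
        rw [hS2, Finset.mul_sum]
        refine Finset.sum_le_sum fun i _ => ?_
        have := sq_nonneg (m * (‖x i‖ - 1))
        nlinarith)
      (fun j => signedSup_sub_le hΦ x (s j)) (fun j => average_signedSup_le hΦ hn x (s j)) u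
      (fun ξ => by
        obtain ⟨j, -, hj⟩ := Finset.exists_mem_eq_sup' (Finset.univ_nonempty (α := Fin k))
          fun j => (signedSup Φ x (s j) ξ).toReal
        exact ⟨j, hj.le⟩)
    rw [Fintype.card_fin] at h1
    have h2 : Real.log k / (√L / (m * S)) ≤ √L * (m * S) := by
      rw [div_div_eq_mul_div, div_le_iff₀ hsL]
      have := Real.mul_self_sqrt hL.le
      calc Real.log k * (m * S) ≤ L * (m * S) := by gcongr
        _ = _ := by linear_combination (-(m * S)) * this
    have h3 : √L / (m * S) * (2 * m ^ 2 * S ^ 2) / 2 = √L * (m * S) := by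
      field_simp
    linarith
  have hpt : ∀ ξ, ⨆ t, signedSup Φ x t ξ ≤
      ENNReal.ofReal (u ξ) + ENNReal.ofReal A₁ * ∑ i, modulus (x i) h := by
    intro ξ
    refine iSup_le fun t => ?_
    obtain ⟨j, hj⟩ := hs t
    refine (signedSup_le_add_modulus hΦ x t (s j) (hj.trans hh) ξ).trans (add_le_add ?_ le_rfl)
    rw [← ENNReal.ofReal_toReal (signedSup_ne_top hΦ x (s j) ξ)]
    exact ENNReal.ofReal_le_ofReal
      (Finset.le_sup' (fun j => (signedSup Φ x (s j) ξ).toReal) (Finset.mem_univ j))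
  have hu0 : ∀ ξ, 0 ≤ u ξ := fun ξ => ENNReal.toReal_nonneg.trans
    (Finset.le_sup' (fun j => (signedSup Φ x (s j) ξ).toReal) (Finset.mem_univ ⟨0, hk⟩))
  have hpow : (2 ^ n : ℝ≥0∞)⁻¹ = ENNReal.ofReal ((2 ^ n : ℝ)⁻¹) := by
    rw [ENNReal.ofReal_inv_of_pos (by positivity), ENNReal.ofReal_pow (by norm_num)]
    simp
  calc (2 ^ n : ℝ≥0∞)⁻¹ * ∑ ξ : Fin n → ℤˣ, ⨆ t, signedSup Φ x t ξ
      ≤ (2 ^ n : ℝ≥0∞)⁻¹ * ∑ ξ : Fin n → ℤˣ,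
          (ENNReal.ofReal (u ξ) + ENNReal.ofReal A₁ * ∑ i, modulus (x i) h) := by
        gcongr with ξ
        exact hpt ξ
    _ = ENNReal.ofReal ((2 ^ n : ℝ)⁻¹ * ∑ ξ, u ξ) +
          ENNReal.ofReal A₁ * ∑ i, modulus (x i) h := by
        rw [Finset.sum_add_distrib, mul_add, ENNReal.ofReal_mul (by positivity), ← hpow,
          ENNReal.ofReal_sum_of_nonneg fun ξ _ => hu0 ξ]
        congr 1
        rw [Finset.sum_const, nsmul_eq_mul, ← mul_assoc]
        simp only [Finset.card_univ, Fintype.card_pi, Finset.prod_const, Fintype.card_fin,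
          Fintype.card_units_int, Nat.cast_pow, Nat.cast_ofNat]
        rw [ENNReal.inv_mul_cancel (by simp) (by simp), one_mul]
    _ ≤ _ := by gcongr

end Rademacher

/-! ### Symmetrization -/

section Symmetrization

variable {d : ℕ} {T : ℝ} {Φ : Set (Eucl d → ℝ)} {A₁ A₂ A₃ : ℝ} {n : ℕ}

/-- The supremum over times and test functions of the signed mean difference of two samples. -/
def signedDeviation (Φ : Set (Eucl d → ℝ)) (ξ : Fin n → ℤˣ)
    (x y : Fin n → PathSpace d T) : ℝ≥0∞ :=
  ⨆ t, ⨆ f ∈ Φ, ‖(n : ℝ)⁻¹ * ∑ i, ((ξ i : ℤ) : ℝ) * (f (y i t) - f (x i t))‖ₑ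

lemma FunctionClass.continuous_coord_eval (hΦ : FunctionClass Φ A₁ A₂ A₃) {f : Eucl d → ℝ}
    (hf : f ∈ Φ) (t : Set.Icc (0 : ℝ) T) (i : Fin n) :
    Continuous fun x : Fin n → PathSpace d T => f (x i t) :=
  (hΦ.continuous hf).comp ((continuous_eval_const t).comp (continuous_apply i))

lemma measurable_signedDeviation (hΦ : FunctionClass Φ A₁ A₂ A₃) (ξ : Fin n → ℤˣ) :
    Measurable fun p : (Fin n → PathSpace d T) × (Fin n → PathSpace d T) =>
      signedDeviation Φ ξ p.1 p.2 := by
  refine LowerSemicontinuous.measurable (lowerSemicontinuous_iSup fun t =>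
    lowerSemicontinuous_biSup fun f hf => Continuous.lowerSemicontinuous ?_)
  refine continuous_enorm.comp (continuous_const.mul
    (continuous_finsetSum _ fun i _ => continuous_const.mul (Continuous.sub ?_ ?_)))
  · exact (hΦ.continuous_coord_eval hf t i).comp continuous_snd
  · exact (hΦ.continuous_coord_eval hf t i).comp continuous_fst

lemma measurable_iSup_signedSup (hΦ : FunctionClass Φ A₁ A₂ A₃) (ξ : Fin n → ℤˣ) :
    Measurable fun x : Fin n → PathSpace d T => ⨆ t, signedSup Φ x t ξ := by
  refine LowerSemicontinuous.measurable (lowerSemicontinuous_iSup fun t =>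
    lowerSemicontinuous_biSup fun f hf => Continuous.lowerSemicontinuous ?_)
  exact continuous_enorm.comp (continuous_finsetSum _ fun i _ =>
    continuous_const.mul (hΦ.continuous_coord_eval hf t i))

lemma measurable_modulus (h : ℝ) : Measurable fun x : PathSpace d T => modulus x h := by
  refine LowerSemicontinuous.measurable (lowerSemicontinuous_iSup fun t =>
    lowerSemicontinuous_iSup fun s => lowerSemicontinuous_iSup fun _ =>
      Continuous.lowerSemicontinuous ?_)
  exact continuous_enorm.comp ((continuous_eval_const t).sub (continuous_eval_const s))

/-- Ghost sample: the μ-integral of f is the mean of an independent empirical integral, and a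
supremum of integrals is at most the integral of the supremum. -/
lemma pathGmmd_le_lintegral (hΦ : FunctionClass Φ A₁ A₂ A₃) (hn : 0 < n)
    (μ : Measure (PathSpace d T)) [IsProbabilityMeasure μ] (hμ : Integrable (fun x => ‖x‖) μ)
    (x : Fin n → PathSpace d T) :
    pathGmmd Φ μ x ≤ ∫⁻ y, signedDeviation Φ 1 x y ∂(Measure.pi fun _ : Fin n => μ) := by
  rw [pathGmmd_eq hΦ]
  refine iSup_le fun t => iSup₂_le fun f hf => ?_
  have hn' : (n : ℝ) ≠ 0 := by positivity
  have hi : Integrable (fun y : PathSpace d T => f (y t)) μ := hΦ.integrable_eval hf μ hμ t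
  have hiy : ∀ i : Fin n, Integrable (fun y : Fin n → PathSpace d T => f (y i t))
      (Measure.pi fun _ : Fin n => μ) := fun i =>
    integrable_comp_eval (μ := fun _ : Fin n => μ) (i := i) (f := fun y => f (y t)) hi
  have e : ∫ y, f (y t) ∂μ - (n : ℝ)⁻¹ * ∑ i, f (x i t) =
      ∫ y, (n : ℝ)⁻¹ * ∑ i, (((1 : Fin n → ℤˣ) i : ℤ) : ℝ) * (f (y i t) - f (x i t))
        ∂(Measure.pi fun _ : Fin n => μ) := by
    simp only [Pi.one_apply, Units.val_one, Int.cast_one, one_mul]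
    have hd : ∀ i : Fin n, Integrable (fun y : Fin n → PathSpace d T => f (y i t) - f (x i t))
        (Measure.pi fun _ : Fin n => μ) := fun i => (hiy i).sub (integrable_const _)
    rw [integral_const_mul, integral_finsetSum _ fun i _ => hd i]
    have : ∀ i : Fin n, ∫ y : Fin n → PathSpace d T, (f (y i t) - f (x i t))
        ∂(Measure.pi fun _ : Fin n => μ) = ∫ y, f (y t) ∂μ - f (x i t) := fun i => by
      rw [integral_sub (hiy i) (integrable_const _)]
      simp [integral_comp_eval (μ := fun _ : Fin n => μ) (i := i) (f := fun y => f (y t))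
        hi.aestronglyMeasurable]
    simp only [this, Finset.sum_sub_distrib, Finset.sum_const, Finset.card_univ,
      Fintype.card_fin, nsmul_eq_mul]
    field_simp
  rw [e]
  refine (enorm_integral_le_lintegral_enorm _).trans (lintegral_mono fun y => ?_)
  exact le_iSup_of_le t (le_iSup₂_of_le f hf le_rfl)

lemma measurable_signedDeviation_pairs (hΦ : FunctionClass Φ A₁ A₂ A₃) :
    Measurable fun z : Fin n → PathSpace d T × PathSpace d T =>
      signedDeviation Φ 1 (fun i => (z i).1) (fun i => (z i).2) := by
  have hp : Measurable fun z : Fin n → PathSpace d T × PathSpace d T =>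
      ((fun i => (z i).1 : Fin n → PathSpace d T), (fun i => (z i).2 : Fin n → PathSpace d T)) :=
    (measurable_pi_lambda _ fun i => (measurable_pi_apply i).fst).prodMk
      (measurable_pi_lambda _ fun i => (measurable_pi_apply i).snd)
  have h := (measurable_signedDeviation (n := n) (T := T) hΦ 1).comp hp
  exact h

/-- Exchanging the two samples in the coordinates where `ξ` is `-1`. -/
lemma lintegral_signedDeviation_eq (hΦ : FunctionClass Φ A₁ A₂ A₃)
    (μ : Measure (PathSpace d T)) [IsProbabilityMeasure μ] (ξ : Fin n → ℤˣ) :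
    ∫⁻ z, signedDeviation Φ 1 (fun i => (z i).1) (fun i => (z i).2)
        ∂(Measure.pi fun _ : Fin n => μ.prod μ) =
      ∫⁻ z, signedDeviation Φ ξ (fun i => (z i).1) (fun i => (z i).2)
        ∂(Measure.pi fun _ : Fin n => μ.prod μ) := by
  have hmeas := measurable_signedDeviation_pairs (T := T) (n := n) hΦ
  -- Swapping a pair preserves μ ⊗ μ and reverses the sign of f(y) - f(x).
  have hmp := measurePreserving_pi (fun _ : Fin n => μ.prod μ) (fun _ : Fin n => μ.prod μ)
    (f := fun i => if ξ i = 1 then id else Prod.swap) (fun i => by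
      by_cases h : ξ i = 1
      · simpa [h] using MeasurePreserving.id (μ.prod μ)
      · simpa [h] using Measure.measurePreserving_swap (μ := μ) (ν := μ))
  rw [← hmp.lintegral_comp hmeas]
  refine lintegral_congr fun z => iSup_congr fun t => biSup_congr fun f hf => ?_
  congr 2
  refine Finset.sum_congr rfl fun i _ => ?_
  rcases Int.units_eq_one_or (ξ i) with h | h
  · simp [h]
  · have : (-1 : ℤˣ) ≠ 1 := by decide
    simp [h, this]

lemma signedDeviation_le (ξ : Fin n → ℤˣ) (x y : Fin n → PathSpace d T) :
    signedDeviation Φ ξ x y ≤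
      (n : ℝ≥0∞)⁻¹ * ((⨆ t, signedSup Φ x t ξ) + ⨆ t, signedSup Φ y t ξ) := by
  rcases Nat.eq_zero_or_pos n with rfl | hn
  · simp [signedDeviation]
  refine iSup_le fun t => iSup₂_le fun f hf => ?_
  have hinv : ‖(n : ℝ)⁻¹‖ₑ = (n : ℝ≥0∞)⁻¹ := by
    rw [enorm_inv (by positivity)]
    simp
  rw [enorm_mul, hinv]
  gcongr
  simp only [mul_sub, Finset.sum_sub_distrib]
  refine enorm_sub_le.trans ?_
  rw [add_comm]
  exact add_le_add (le_iSup_of_le t (le_iSup₂_of_le f hf le_rfl))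
    (le_iSup_of_le t (le_iSup₂_of_le f hf le_rfl))

/-- Symmetrization: the expected discrepancy is at most twice the expected Rademacher average. -/
theorem lintegral_pathGmmd_le (hΦ : FunctionClass Φ A₁ A₂ A₃) (hn : 0 < n)
    (μ : Measure (PathSpace d T)) [IsProbabilityMeasure μ] (hμ : Integrable (fun x => ‖x‖) μ) :
    ∫⁻ x, pathGmmd Φ μ x ∂(Measure.pi fun _ : Fin n => μ) ≤
      2 * (n : ℝ≥0∞)⁻¹ * ∫⁻ x, (2 ^ n : ℝ≥0∞)⁻¹ * ∑ ξ : Fin n → ℤˣ, ⨆ t, signedSup Φ x t ξ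
        ∂(Measure.pi fun _ : Fin n => μ) := by
  set D := ∫⁻ x, pathGmmd Φ μ x ∂(Measure.pi fun _ : Fin n => μ)
  have hξ : ∀ ξ : Fin n → ℤˣ, D ≤ 2 * (n : ℝ≥0∞)⁻¹ *
      ∫⁻ x, ⨆ t, signedSup Φ x t ξ ∂(Measure.pi fun _ : Fin n => μ) := by
    intro ξ
    have hms := measurable_iSup_signedSup (T := T) hΦ ξ
    have h1 := measurePreserving_pi (fun _ : Fin n => μ.prod μ) (fun _ : Fin n => μ)
      (f := fun _ => Prod.fst) fun _ => measurePreserving_fst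
    have h2 := measurePreserving_pi (fun _ : Fin n => μ.prod μ) (fun _ : Fin n => μ)
      (f := fun _ => Prod.snd) fun _ => measurePreserving_snd
    calc D ≤ ∫⁻ x, ∫⁻ y, signedDeviation Φ 1 x y ∂(Measure.pi fun _ : Fin n => μ)
            ∂(Measure.pi fun _ : Fin n => μ) :=
          lintegral_mono fun x => pathGmmd_le_lintegral hΦ hn μ hμ x
      _ = ∫⁻ p, signedDeviation Φ 1 p.1 p.2
            ∂((Measure.pi fun _ : Fin n => μ).prod (Measure.pi fun _ : Fin n => μ)) :=
          (lintegral_prod _ (measurable_signedDeviation hΦ 1).aemeasurable).symm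
      _ = ∫⁻ z, signedDeviation Φ 1 (fun i => (z i).1) (fun i => (z i).2)
            ∂(Measure.pi fun _ : Fin n => μ.prod μ) :=
          ((measurePreserving_arrowProdEquivProdArrow _ _ (Fin n) (fun _ => μ)
            fun _ => μ).lintegral_comp (measurable_signedDeviation hΦ 1)).symm
      _ = ∫⁻ z, signedDeviation Φ ξ (fun i => (z i).1) (fun i => (z i).2)
            ∂(Measure.pi fun _ : Fin n => μ.prod μ) := lintegral_signedDeviation_eq hΦ μ ξ
      _ ≤ ∫⁻ z, (n : ℝ≥0∞)⁻¹ * ((⨆ t, signedSup Φ (fun i => (z i).1) t ξ) +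
            ⨆ t, signedSup Φ (fun i => (z i).2) t ξ) ∂(Measure.pi fun _ : Fin n => μ.prod μ) :=
          lintegral_mono fun z => signedDeviation_le ξ _ _
      _ = _ := by
          have hms1 : Measurable fun z : Fin n → PathSpace d T × PathSpace d T =>
            ⨆ t, signedSup Φ (fun i => (z i).1) t ξ := hms.comp h1.measurable
          rw [lintegral_const_mul' _ _ (by simp [hn.ne']), lintegral_add_left hms1,
            h1.lintegral_comp hms, h2.lintegral_comp hms, ← two_mul, ← mul_assoc, mul_comm _ 2]
  have havg : D = (2 ^ n : ℝ≥0∞)⁻¹ * ∑ _ξ : Fin n → ℤˣ, D := by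
    rw [Finset.sum_const, nsmul_eq_mul, ← mul_assoc]
    simp only [Finset.card_univ, Fintype.card_pi, Finset.prod_const, Fintype.card_fin,
      Fintype.card_units_int, Nat.cast_pow, Nat.cast_ofNat]
    rw [ENNReal.inv_mul_cancel (by simp) (by simp), one_mul]
  rw [lintegral_const_mul' _ _ (by simp),
    lintegral_finsetSum _ fun ξ _ => measurable_iSup_signedSup hΦ ξ, havg, mul_left_comm,
    Finset.mul_sum _ _ (2 * (n : ℝ≥0∞)⁻¹)]
  gcongr with ξ
  exact hξ ξ

end Symmetrization

/-! ### The rate -/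

section Rate

/-- Both logarithms are expressed through L = log 2 + log n / (2α) = log (2 n^(1/(2α))), which also
bounds the logarithm of the number of grid times. -/
lemma rate_eq {T A₁ A₂ A₃ Q α β M : ℝ} (hα : 0 < α) {n : ℕ} (hn : 0 < n) :
    rate T A₁ A₂ A₃ Q α β M n =
      2 * ((A₃ + 8 * max A₁ A₂) + 8 * max A₁ A₂ * √(Real.log 2 + Real.log n / (2 * α))) / √n *
        √(M + 1) + 2 * (A₁ * Q * T ^ α) / √n *
          (Real.log 2 + Real.log n / (2 * α) + Real.log 2) ^ β := by
  have hn' : (0 : ℝ) < n := by positivity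
  have h1 : Real.log (2 ^ (2 * α) * n) / (2 * α * n) =
      (Real.log 2 + Real.log n / (2 * α)) / n := by
    rw [Real.log_mul (by positivity) hn'.ne', Real.log_rpow (by norm_num)]
    field_simp
  have h2 : Real.log (2 ^ (4 * α) * n) / (2 * α) =
      Real.log 2 + Real.log n / (2 * α) + Real.log 2 := by
    rw [Real.log_mul (by positivity) hn'.ne', Real.log_rpow (by norm_num)]
    field_simp
    ring
  rw [rate, h1, h2, Real.sqrt_div' _ hn'.le, ← Real.sqrt_eq_rpow]
  ring

lemma rate_nonneg {T A₁ A₂ A₃ Q α β M : ℝ} (hT : 0 ≤ T) (hA₁ : 0 ≤ A₁) (hA₃ : 0 ≤ A₃)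
    (hQ : 0 ≤ Q) (hα : 0 < α) {n : ℕ} (hn : 0 < n) :
    0 ≤ rate T A₁ A₂ A₃ Q α β M n := by
  rw [rate_eq hα hn]
  have h1 : 0 ≤ max A₁ A₂ := le_max_of_le_left hA₁
  have h2 : 0 ≤ Real.log n := Real.log_natCast_nonneg n
  have h3 : 0 ≤ Real.log 2 := Real.log_nonneg (by norm_num)
  positivity

lemma rate_isBigO {T A₁ A₂ A₃ Q α β M : ℝ} (hT : 0 ≤ T) (hA₁ : 0 ≤ A₁) (hA₃ : 0 ≤ A₃)
    (hQ : 0 ≤ Q) (hα : 0 < α) (hβ : 0 ≤ β) :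
    rate T A₁ A₂ A₃ Q α β M =O[atTop] fun n : ℕ =>
      (n : ℝ) ^ (-(1 / 2) : ℝ) * Real.log n ^ max β (1 / 2) := by
  have hm : 0 ≤ max A₁ A₂ := le_max_of_le_left hA₁
  have hl2 : 0 ≤ Real.log 2 := Real.log_nonneg (by norm_num)
  set c₁ := Real.log 2 + 1 / (2 * α)
  set c₂ := Real.log 2 + 1 / (2 * α) + Real.log 2
  have hc₁ : 0 ≤ c₁ := by positivity
  have hc₂ : 0 ≤ c₂ := by positivity
  refine Asymptotics.IsBigO.of_bound
    (2 * ((A₃ + 8 * max A₁ A₂) + 8 * max A₁ A₂ * √c₁) * √(M + 1) +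
      2 * (A₁ * Q * T ^ α) * c₂ ^ β) ?_
  -- From n = 3 on, log n ≥ 1, so 1, √(log n) and (log n)^β are all at most (log n)^max(β, 1/2).
  filter_upwards [eventually_ge_atTop 3] with n hn
  have hn0 : 0 < n := by omega
  have hn' : (0 : ℝ) < n := by positivity
  have hlog : 1 ≤ Real.log n := by
    rw [Real.le_log_iff_exp_le hn']
    have : (3 : ℝ) ≤ n := by exact_mod_cast hn
    linarith [Real.exp_one_lt_d9]
  set l := Real.log n
  have hl0 : 0 ≤ l := by linarith
  have hp1 : 1 ≤ l ^ max β (1 / 2) := Real.one_le_rpow hlog (by positivity)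
  have hp2 : √l ≤ l ^ max β (1 / 2) := by
    rw [Real.sqrt_eq_rpow]
    exact Real.rpow_le_rpow_of_exponent_le hlog (le_max_right _ _)
  have hp3 : l ^ β ≤ l ^ max β (1 / 2) :=
    Real.rpow_le_rpow_of_exponent_le hlog (le_max_left _ _)
  have hL1 : √(Real.log 2 + l / (2 * α)) ≤ √c₁ * l ^ max β (1 / 2) := by
    refine le_trans ?_ (mul_le_mul_of_nonneg_left hp2 (Real.sqrt_nonneg _))
    rw [← Real.sqrt_mul hc₁]
    refine Real.sqrt_le_sqrt ?_
    have : Real.log 2 * 1 ≤ Real.log 2 * l := by gcongr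
    calc Real.log 2 + l / (2 * α) ≤ Real.log 2 * l + l / (2 * α) := by linarith
      _ = c₁ * l := by simp only [c₁]; ring
  have hL2 : (Real.log 2 + l / (2 * α) + Real.log 2) ^ β ≤ c₂ ^ β * l ^ max β (1 / 2) := by
    refine le_trans ?_ (mul_le_mul_of_nonneg_left hp3 (by positivity))
    rw [← Real.mul_rpow hc₂ hl0]
    refine Real.rpow_le_rpow (by positivity) ?_ hβ
    have : Real.log 2 * 1 ≤ Real.log 2 * l := by gcongr
    calc Real.log 2 + l / (2 * α) + Real.log 2
        ≤ Real.log 2 * l + l / (2 * α) + Real.log 2 * l := by linarith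
      _ = c₂ * l := by simp only [c₂]; ring
  have hsq : (n : ℝ) ^ (-(1 / 2) : ℝ) = (√n)⁻¹ := by
    rw [Real.rpow_neg hn'.le, Real.sqrt_eq_rpow]
  rw [Real.norm_eq_abs, abs_of_nonneg (rate_nonneg hT hA₁ hA₃ hQ hα hn0), rate_eq hα hn0,
    Real.norm_eq_abs, abs_of_nonneg (by positivity), hsq]
  set p := l ^ max β (1 / 2)
  have hA : A₃ + 8 * max A₁ A₂ ≤ (A₃ + 8 * max A₁ A₂) * p :=
    le_mul_of_one_le_right (by positivity) hp1
  calc _ ≤ 2 * ((A₃ + 8 * max A₁ A₂) * p + 8 * max A₁ A₂ * (√c₁ * p)) / √n * √(M + 1) +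
        2 * (A₁ * Q * T ^ α) / √n * (c₂ ^ β * p) := by gcongr
    _ = _ := by ring

end Rate

/-! ### The expectation bound -/

section Expectation

variable {d : ℕ} {T : ℝ} {Φ : Set (Eucl d → ℝ)} {A₁ A₂ A₃ : ℝ} {n : ℕ}

lemma lintegral_sqrt_sum_le (hn : 0 < n) (μ : Measure (PathSpace d T)) [IsProbabilityMeasure μ]
    (hμ : Integrable (fun x => ‖x‖ ^ 2) μ) :
    ∫⁻ x, ENNReal.ofReal √(∑ i, (‖x i‖ ^ 2 + 1)) ∂(Measure.pi fun _ : Fin n => μ) ≤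
      ENNReal.ofReal √(n * (∫ x, ‖x‖ ^ 2 ∂μ + 1)) := by
  set M := ∫ x, ‖x‖ ^ 2 ∂μ
  have hM : 0 ≤ M := integral_nonneg fun x => sq_nonneg _
  set c := √(n * (M + 1)) with hc
  have hc0 : 0 < c := Real.sqrt_pos.2 (by positivity)
  have hc2 : c ^ 2 = n * (M + 1) := Real.sq_sqrt (by positivity)
  have hi : ∀ i : Fin n, Integrable (fun x : Fin n → PathSpace d T => ‖x i‖ ^ 2 + 1)
      (Measure.pi fun _ : Fin n => μ) := fun i =>
    (integrable_comp_eval (μ := fun _ : Fin n => μ) (i := i) (f := fun x => ‖x‖ ^ 2) hμ).add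
      (integrable_const _)
  have hsum : Integrable (fun x : Fin n → PathSpace d T => ∑ i, (‖x i‖ ^ 2 + 1))
      (Measure.pi fun _ : Fin n => μ) := integrable_finsetSum _ fun i _ => hi i
  have hval : ∫ x : Fin n → PathSpace d T, ∑ i, (‖x i‖ ^ 2 + 1)
      ∂(Measure.pi fun _ : Fin n => μ) = c ^ 2 := by
    rw [integral_finsetSum _ fun i _ => hi i, hc2]
    have : ∀ i : Fin n, ∫ x : Fin n → PathSpace d T, (‖x i‖ ^ 2 + 1)
        ∂(Measure.pi fun _ : Fin n => μ) = M + 1 := fun i => by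
      rw [integral_comp_eval (μ := fun _ : Fin n => μ) (i := i) (f := fun x => ‖x‖ ^ 2 + 1)
        (hμ.add (integrable_const _)).aestronglyMeasurable, integral_add hμ (integrable_const _)]
      simp [M]
    simp [this, mul_add]
  -- Jensen's inequality for the square root in tangent form: s ≤ (s²/c + c)/2, with c² the mean of
  -- s².
  calc ∫⁻ x, ENNReal.ofReal √(∑ i, (‖x i‖ ^ 2 + 1)) ∂(Measure.pi fun _ : Fin n => μ)
      ≤ ∫⁻ x, ENNReal.ofReal ((2 * c)⁻¹ * (∑ i, (‖x i‖ ^ 2 + 1)) + c / 2)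
          ∂(Measure.pi fun _ : Fin n => μ) := by
        refine lintegral_mono fun x => ENNReal.ofReal_le_ofReal ?_
        have h0 : 0 ≤ ∑ i, (‖x i‖ ^ 2 + 1) := Finset.sum_nonneg fun i _ => by positivity
        set s := √(∑ i, (‖x i‖ ^ 2 + 1)) with hs
        have hs2 : s ^ 2 = ∑ i, (‖x i‖ ^ 2 + 1) := Real.sq_sqrt h0
        rw [← hs2, show (2 * c)⁻¹ * s ^ 2 + c / 2 = (s ^ 2 + c ^ 2) / (2 * c) by field_simp,
          le_div_iff₀ (by positivity)]
        nlinarith [sq_nonneg (s - c)]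
    _ = ENNReal.ofReal c := by
        rw [← ofReal_integral_eq_lintegral_ofReal
          (f := fun x : Fin n → PathSpace d T => (2 * c)⁻¹ * (∑ i, (‖x i‖ ^ 2 + 1)) + c / 2)
          ((hsum.const_mul _).add (integrable_const _)) (.of_forall fun x => ?_)]
        · rw [integral_add (hsum.const_mul _) (integrable_const _), integral_const_mul, hval]
          congr 1
          simp only [integral_const, probReal_univ, smul_eq_mul, one_mul]
          field_simp
          norm_num
        · have h0 : 0 ≤ ∑ i, (‖x i‖ ^ 2 + 1) := Finset.sum_nonneg fun i _ => by positivity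
          positivity

/-- The expected discrepancy, in terms of a time scale `h` and of a number `k` of time steps. -/
lemma lintegral_pathGmmd_le_of_grid (hΦ : FunctionClass Φ A₁ A₂ A₃) (hT : 0 < T) (hn : 0 < n)
    (μ : Measure (PathSpace d T)) [IsProbabilityMeasure μ]
    (hμ : Integrable (fun x => ‖x‖ ^ 2) μ) {k : ℕ} (hk : 0 < k) {h L B : ℝ} (hh : T / k ≤ h)
    (hL : 0 < L) (hkL : Real.log k ≤ L) (hB0 : 0 ≤ B)
    (hB : ∫⁻ x, modulus x h ∂μ ≤ ENNReal.ofReal B) :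
    ∫⁻ x, pathGmmd Φ μ x ∂(Measure.pi fun _ : Fin n => μ) ≤
      ENNReal.ofReal (2 * (A₃ + 2 * max A₁ A₂ * √L) / √n * √(∫ x, ‖x‖ ^ 2 ∂μ + 1) +
        2 * A₁ * B) := by
  have hA1 := hΦ.A₁_pos
  have hA3 := hΦ.A₃_pos
  have hm := hΦ.max_pos
  have hn' : (0 : ℝ) < n := by positivity
  set M := ∫ x, ‖x‖ ^ 2 ∂μ
  have hM : 0 ≤ M := integral_nonneg fun x => sq_nonneg _
  set C := A₃ + 2 * max A₁ A₂ * √L with hC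
  have hC0 : 0 ≤ C := by positivity
  have hmod : ∀ i : Fin n, Measurable fun x : Fin n → PathSpace d T => modulus (x i) h :=
    fun i => (measurable_modulus h).comp (measurable_pi_apply i)
  have hmods : Measurable fun x : Fin n → PathSpace d T =>
      ENNReal.ofReal A₁ * ∑ i, modulus (x i) h :=
    (Finset.measurable_fun_sum _ fun i _ => hmod i).const_mul _
  have hI : ∫⁻ x, (2 ^ n : ℝ≥0∞)⁻¹ * ∑ ξ : Fin n → ℤˣ, ⨆ t, signedSup Φ x t ξ
      ∂(Measure.pi fun _ : Fin n => μ) ≤ ENNReal.ofReal (C * √(n * (M + 1)) + A₁ * (n * B)) := by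
    calc _ ≤ ∫⁻ x, (ENNReal.ofReal C * ENNReal.ofReal √(∑ i, (‖x i‖ ^ 2 + 1)) +
          ENNReal.ofReal A₁ * ∑ i, modulus (x i) h) ∂(Measure.pi fun _ : Fin n => μ) := by
          refine lintegral_mono fun x => ?_
          rw [← ENNReal.ofReal_mul hC0]
          exact average_iSup_signedSup_le hΦ hT hn x hk hh hL hkL
      _ = ENNReal.ofReal C * ∫⁻ x, ENNReal.ofReal √(∑ i, (‖x i‖ ^ 2 + 1))
            ∂(Measure.pi fun _ : Fin n => μ) +
          ENNReal.ofReal A₁ * ∑ _i : Fin n, ∫⁻ x, modulus x h ∂μ := by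
          rw [lintegral_add_right _ hmods,
            lintegral_const_mul' _ _ ENNReal.ofReal_ne_top,
            lintegral_const_mul' _ _ ENNReal.ofReal_ne_top, lintegral_finsetSum _ fun i _ => hmod i]
          congr 2
          refine Finset.sum_congr rfl fun i _ => ?_
          exact (measurePreserving_eval (fun _ : Fin n => μ) i).lintegral_comp (measurable_modulus h)
      _ ≤ ENNReal.ofReal C * ENNReal.ofReal √(n * (M + 1)) +
          ENNReal.ofReal A₁ * ∑ _i : Fin n, ENNReal.ofReal B := by
          gcongr
          exact lintegral_sqrt_sum_le hn μ hμ
      _ = _ := by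
          rw [Finset.sum_const, Finset.card_univ, Fintype.card_fin, nsmul_eq_mul,
            ENNReal.ofReal_add (p := C * √(n * (M + 1))) (by positivity) (by positivity),
            ENNReal.ofReal_mul hC0,
            ENNReal.ofReal_mul hA1.le, ENNReal.ofReal_mul hn'.le, ENNReal.ofReal_natCast]
  refine (lintegral_pathGmmd_le hΦ hn μ (integrable_norm_of_sq μ hμ)).trans ?_
  have hc : (2 * (n : ℝ≥0∞)⁻¹) = ENNReal.ofReal (2 * (n : ℝ)⁻¹) := by
    rw [ENNReal.ofReal_mul (by norm_num), ENNReal.ofReal_inv_of_pos hn', ENNReal.ofReal_natCast]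
    simp
  rw [hc]
  refine (mul_le_mul_right hI _).trans_eq ?_
  rw [← ENNReal.ofReal_mul (by positivity)]
  congr 1
  have hs : (n : ℝ) = √n * √n := (Real.mul_self_sqrt hn'.le).symm
  have hs0 : 0 < √(n : ℝ) := Real.sqrt_pos.2 hn'
  rw [Real.sqrt_mul hn'.le]
  have e1 : 2 * (n : ℝ)⁻¹ * (A₁ * (n * B)) = 2 * A₁ * B := by field_simp
  have e2 : 2 * (n : ℝ)⁻¹ * (C * (√n * √(M + 1))) = 2 * C / √n * √(M + 1) := by
    rw [show (n : ℝ)⁻¹ = (√n)⁻¹ * (√n)⁻¹ by rw [← mul_inv, ← hs]]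
    field_simp
  rw [mul_add, e1, e2]

/-- The scale is h = T / r with r = n^(1/(2α)), and the grid has ⌈r⌉ points. Then 2T/h = 2r, so the
logarithm in the modulus bound is the same L that controls the number of grid times. -/
theorem lintegral_pathGmmd_le_rate (hΦ : FunctionClass Φ A₁ A₂ A₃) (hT : 0 < T) (hn : 0 < n)
    (μ : Measure (PathSpace d T)) [IsProbabilityMeasure μ] {Q α β : ℝ}
    (hQ : ModulusBound μ Q α β) (hμ : Integrable (fun x => ‖x‖ ^ 2) μ) :
    ∫⁻ x, pathGmmd Φ μ x ∂(Measure.pi fun _ : Fin n => μ) ≤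
      ENNReal.ofReal (rate T A₁ A₂ A₃ Q α β (∫ x, ‖x‖ ^ 2 ∂μ) n) := by
  have hA1 := hΦ.A₁_pos
  have hA3 := hΦ.A₃_pos
  have hm := hΦ.max_pos
  have hα := hQ.α_pos
  have hβ := hQ.β_pos
  have hQp := hQ.Q_pos
  have hn' : (0 : ℝ) < n := by positivity
  have hn1 : (1 : ℝ) ≤ n := by exact_mod_cast hn
  have hl2 : 0 < Real.log 2 := Real.log_pos (by norm_num)
  have hln : 0 ≤ Real.log n := Real.log_natCast_nonneg n
  set r : ℝ := (n : ℝ) ^ (1 / (2 * α)) with hr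
  have hr1 : 1 ≤ r := Real.one_le_rpow hn1 (by positivity)
  have hr0 : 0 < r := by linarith
  set L := Real.log 2 + Real.log n / (2 * α) with hL
  have hL0 : 0 < L := by positivity
  have hlog2r : Real.log (2 * r) = L := by
    rw [Real.log_mul (by norm_num) hr0.ne', hr, Real.log_rpow hn', hL]
    ring
  have hk : 0 < ⌈r⌉₊ := Nat.ceil_pos.2 hr0
  have hk' : (0 : ℝ) < ⌈r⌉₊ := by exact_mod_cast hk
  have hmesh : T / ⌈r⌉₊ ≤ T / r := by
    gcongr
    exact Nat.le_ceil r
  have hkL : Real.log ⌈r⌉₊ ≤ L := by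
    rw [← hlog2r]
    -- Since r ≥ 1, ⌈r⌉ ≤ r + 1 ≤ 2r.
    refine Real.log_le_log hk' ?_
    linarith [Nat.ceil_lt_add_one hr0.le]
  have hB := hQ.bound (T / r) (by positivity) (div_le_self hT.le hr1)
  have hTr : 2 * T / (T / r) = 2 * r := by field_simp
  have hrα : (T / r) ^ α = T ^ α / √n := by
    rw [Real.div_rpow hT.le hr0.le, hr, ← Real.rpow_mul hn'.le, Real.sqrt_eq_rpow]
    congr 2
    field_simp
  rw [hTr, hlog2r, hrα] at hB
  refine (lintegral_pathGmmd_le_of_grid hΦ hT hn μ hμ hk hmesh hL0 hkL (by positivity) hB).trans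
    (ENNReal.ofReal_le_ofReal ?_)
  rw [rate_eq hα hn]
  have hsn : 0 < √(n : ℝ) := Real.sqrt_pos.2 hn'
  -- The stated rate leaves room: the constant obtained is 2 max(A₁, A₂) against 8, and L against L
  -- + log 2.
  refine add_le_add ?_ ?_
  · gcongr 2 * ?_ / √(n : ℝ) * _
    nlinarith [mul_nonneg hm.le (Real.sqrt_nonneg L)]
  · calc 2 * A₁ * (Q * (T ^ α / √n) * L ^ β) = 2 * (A₁ * Q * T ^ α) / √n * L ^ β := by ring
      _ ≤ 2 * (A₁ * Q * T ^ α) / √n * (L + Real.log 2) ^ β := by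
          gcongr
          linarith

end Expectation

/-! ### Second moment and concentration -/

section Concentration

variable {d : ℕ} {T : ℝ} {Φ : Set (Eucl d → ℝ)} {A₁ A₂ A₃ : ℝ} {n : ℕ}

lemma integral_toReal_pathGmmd_le (hΦ : FunctionClass Φ A₁ A₂ A₃) (hn : 0 < n)
    (μ : Measure (PathSpace d T)) [IsProbabilityMeasure μ] (hμ : Integrable (fun x => ‖x‖) μ)
    {r : ℝ} (hr0 : 0 ≤ r)
    (hr : ∫⁻ x, pathGmmd Φ μ x ∂(Measure.pi fun _ : Fin n => μ) ≤ ENNReal.ofReal r) :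
    ∫ x, (pathGmmd Φ μ x).toReal ∂(Measure.pi fun _ : Fin n => μ) ≤ r := by
  rw [integral_toReal (measurable_pathGmmd hΦ μ).aemeasurable
    (.of_forall fun x => (pathGmmd_ne_top hΦ hn μ hμ x).lt_top)]
  exact ENNReal.toReal_le_of_le_ofReal hr0 hr

lemma lintegral_sq_pathGmmd_le (hΦ : FunctionClass Φ A₁ A₂ A₃) (hn : 0 < n)
    (μ : Measure (PathSpace d T)) [IsProbabilityMeasure μ]
    (hμ : Integrable (fun x => ‖x‖ ^ 2) μ) {r : ℝ} (hr0 : 0 ≤ r)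
    (hr : ∫⁻ x, pathGmmd Φ μ x ∂(Measure.pi fun _ : Fin n => μ) ≤ ENNReal.ofReal r) :
    ∫⁻ x, pathGmmd Φ μ x ^ 2 ∂(Measure.pi fun _ : Fin n => μ) ≤
      ENNReal.ofReal (A₁ ^ 2 / n * ∫ x, ‖x‖ ^ 2 ∂μ + r ^ 2) := by
  have hA1 := hΦ.A₁_pos
  have hn' : (0 : ℝ) < n := by positivity
  have hμ1 := integrable_norm_of_sq μ hμ
  have h := lintegral_sq_pi_le μ (by positivity : 0 ≤ A₁ / n) (0 : PathSpace d T)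
    (by simpa using hμ) n _ (coordLipschitz_pathGmmd hΦ hn μ hμ1)
  have hm := integral_toReal_pathGmmd_le hΦ hn μ hμ1 hr0 hr
  have hm0 : 0 ≤ ∫ x, (pathGmmd Φ μ x).toReal ∂(Measure.pi fun _ : Fin n => μ) :=
    integral_nonneg fun x => ENNReal.toReal_nonneg
  simp only [dist_zero_right] at h
  calc _ = ∫⁻ x, ENNReal.ofReal ((pathGmmd Φ μ x).toReal ^ 2)
        ∂(Measure.pi fun _ : Fin n => μ) := by
        refine lintegral_congr fun x => ?_
        rw [ENNReal.ofReal_pow ENNReal.toReal_nonneg,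
          ENNReal.ofReal_toReal (pathGmmd_ne_top hΦ hn μ hμ1 x)]
    _ ≤ _ := h
    _ ≤ _ := by
        refine ENNReal.ofReal_le_ofReal ?_
        rw [add_comm]
        refine add_le_add (le_of_eq ?_) (pow_le_pow_left₀ hm0 hm 2)
        field_simp

lemma measure_pathGmmd_ge_le (hΦ : FunctionClass Φ A₁ A₂ A₃) (hn : 0 < n)
    (μ : Measure (PathSpace d T)) [IsProbabilityMeasure μ]
    (hμ : Integrable (fun x => ‖x‖) μ) {r : ℝ} (hr0 : 0 ≤ r)
    (hr : ∫⁻ x, pathGmmd Φ μ x ∂(Measure.pi fun _ : Fin n => μ) ≤ ENNReal.ofReal r)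
    {κ : ℝ} (hκ : 0 < κ) (hT1 : TransportInequality₁ μ κ) {a : ℝ} (ha : 0 ≤ a) :
    (Measure.pi fun _ : Fin n => μ) {x | ENNReal.ofReal (r + a) ≤ pathGmmd Φ μ x} ≤
      ENNReal.ofReal (Real.exp (-(n * a ^ 2 / (2 * A₁ ^ 2 * κ ^ 2)))) := by
  have hA1 := hΦ.A₁_pos
  have hn' : (0 : ℝ) < n := by positivity
  have hm := integral_toReal_pathGmmd_le hΦ hn μ hμ hr0 hr
  -- The minimizer of -lam a + lam² A₁² κ² / (2n), the Chernoff exponent.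
  set lam := a * n / (A₁ ^ 2 * κ ^ 2) with hlam
  have hlam0 : 0 ≤ lam := by positivity
  set c := lam * (A₁ / n) with hc
  have hc0 : 0 ≤ c := by positivity
  have hg : CoordLipschitz c fun x : Fin n → PathSpace d T =>
      lam * (pathGmmd Φ μ x).toReal := fun x y => by
    rw [← mul_sub, abs_mul, abs_of_nonneg hlam0, hc, mul_assoc]
    exact mul_le_mul_of_nonneg_left (coordLipschitz_pathGmmd hΦ hn μ hμ x y) hlam0
  have h := lintegral_exp_pi_le μ hc0 (0 : PathSpace d T) (by simpa using hμ)
    (K := c ^ 2 * κ ^ 2 / 2) (fun h hh => by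
      refine integral_exp_le_of_transport hc0 hκ h hh μ ?_ hT1
      have hcont : Continuous h := (LipschitzWith.of_dist_le' (K := c) fun x y => by
        rw [Real.dist_eq]; exact hh x y).continuous
      refine ((hμ.const_mul c).add (integrable_const |h 0|)).mono'
        hcont.measurable.aestronglyMeasurable (.of_forall fun x => ?_)
      have h1 := abs_sub_abs_le_abs_sub (h x) (h 0)
      have h2 := hh x 0
      rw [dist_zero_right] at h2
      simp only [Real.norm_eq_abs, Pi.add_apply]
      linarith) n _ hg
  rw [integral_const_mul] at h
  have hmeas : Measurable fun x : Fin n → PathSpace d T =>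
      ENNReal.ofReal (Real.exp (lam * (pathGmmd Φ μ x).toReal)) :=
    (Real.measurable_exp.comp ((measurable_pathGmmd hΦ μ).ennreal_toReal.const_mul lam)).ennreal_ofReal
  have hmarkov := mul_meas_ge_le_lintegral (μ := Measure.pi fun _ : Fin n => μ) hmeas
    (ENNReal.ofReal (Real.exp (lam * (r + a))))
  have hsub : {x : Fin n → PathSpace d T | ENNReal.ofReal (r + a) ≤ pathGmmd Φ μ x} ⊆
      {x | ENNReal.ofReal (Real.exp (lam * (r + a))) ≤
        ENNReal.ofReal (Real.exp (lam * (pathGmmd Φ μ x).toReal))} := by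
    intro x hx
    refine ENNReal.ofReal_le_ofReal (Real.exp_le_exp.2 (mul_le_mul_of_nonneg_left ?_ hlam0))
    exact (ENNReal.ofReal_le_iff_le_toReal (pathGmmd_ne_top hΦ hn μ hμ x)).1 hx
  refine (measure_mono hsub).trans ?_
  have hpos : 0 < Real.exp (lam * (r + a)) := Real.exp_pos _
  rw [← ENNReal.mul_le_mul_iff_right (a := ENNReal.ofReal (Real.exp (lam * (r + a))))
    (by simpa using hpos) ENNReal.ofReal_ne_top]
  refine (hmarkov.trans h).trans ?_
  rw [← ENNReal.ofReal_mul hpos.le, ← Real.exp_add]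
  refine ENNReal.ofReal_le_ofReal (Real.exp_le_exp.2 ?_)
  have e1 : n * (c ^ 2 * κ ^ 2 / 2) = n * a ^ 2 / (2 * A₁ ^ 2 * κ ^ 2) := by
    rw [hc, hlam]
    field_simp
  have e2 : lam * a = 2 * (n * a ^ 2 / (2 * A₁ ^ 2 * κ ^ 2)) := by
    rw [hlam]
    field_simp
  have e3 := mul_le_mul_of_nonneg_left hm hlam0
  rw [mul_add]
  linarith

end Concentration

end GMMD

end

theorem theorem2p3 {d : ℕ} {T : ℝ} (hT : 0 < T)
    (Φ : Set (GMMD.Eucl d → ℝ)) (A₁ A₂ A₃ : ℝ) (hΦ : GMMD.FunctionClass Φ A₁ A₂ A₃)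
    (μ : Measure (GMMD.PathSpace d T)) [IsProbabilityMeasure μ]
    (Q α β : ℝ) (hμ : GMMD.ModulusBound μ Q α β)
    (hmoment : Integrable (fun x : GMMD.PathSpace d T => ⨆ t, ‖x t‖ ^ 2) μ)
    (φ : ℕ → ℝ) (hφ : φ = GMMD.rate T A₁ A₂ A₃ Q α β (GMMD.supSecondMoment μ)) :
    (φ =O[atTop] fun n : ℕ =>
      (n : ℝ) ^ (-(1 / 2) : ℝ) * Real.log n ^ max β (1 / 2)) ∧
    ∀ (n : ℕ), 0 < n → ∀ {Ω : Type*} [MeasurableSpace Ω] (P : Measure Ω) [IsProbabilityMeasure P]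
      (X : Fin n → Ω → GMMD.PathSpace d T),
      (∀ i, Measurable (X i)) → (∀ i, P.map (X i) = μ) → iIndepFun X P →
      Measurable (fun ω => ⨆ t, GMMD.gmmd Φ (GMMD.marginal μ t) (GMMD.empirical fun i => X i ω t)) ∧
      ∫⁻ ω, (⨆ t, GMMD.gmmd Φ (GMMD.marginal μ t) (GMMD.empirical fun i => X i ω t)) ∂P
        ≤ ENNReal.ofReal (φ n) ∧
      ∫⁻ ω, (⨆ t, GMMD.gmmd Φ (GMMD.marginal μ t) (GMMD.empirical fun i => X i ω t) ^ 2) ∂P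
        ≤ ENNReal.ofReal (A₁ ^ 2 / n * GMMD.supSecondMoment μ + φ n ^ 2) ∧
      ∀ κ : ℝ, 0 < κ → GMMD.TransportInequality₁ μ κ → ∀ a : ℝ, 0 ≤ a →
        P {ω | ENNReal.ofReal (φ n + a) ≤
            ⨆ t, GMMD.gmmd Φ (GMMD.marginal μ t) (GMMD.empirical fun i => X i ω t)}
          ≤ ENNReal.ofReal (Real.exp (-(n * a ^ 2 / (2 * A₁ ^ 2 * κ ^ 2)))) := by
  have hnorm : (fun x : GMMD.PathSpace d T => ⨆ t, ‖x t‖ ^ 2) = fun x => ‖x‖ ^ 2 :=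
    funext fun x => GMMD.iSup_norm_sq_eq hT x
  have hM : GMMD.supSecondMoment μ = ∫ x, ‖x‖ ^ 2 ∂μ := by
    rw [GMMD.supSecondMoment, hnorm]
  have hμ2 : Integrable (fun x : GMMD.PathSpace d T => ‖x‖ ^ 2) μ := hnorm ▸ hmoment
  have hμ1 := GMMD.integrable_norm_of_sq μ hμ2
  rw [hM] at hφ ⊢
  refine ⟨hφ ▸ GMMD.rate_isBigO hT.le hΦ.A₁_pos.le hΦ.A₃_pos.le hμ.Q_pos.le hμ.α_pos hμ.β_pos.le,
    ?_⟩
  intro n hn Ω _ P _ X hX hXμ hind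
  have hφ0 : 0 ≤ φ n :=
    hφ ▸ GMMD.rate_nonneg hT.le hΦ.A₁_pos.le hΦ.A₃_pos.le hμ.Q_pos.le hμ.α_pos hn
  have hbound : ∫⁻ x, GMMD.pathGmmd Φ μ x ∂(Measure.pi fun _ : Fin n => μ) ≤
      ENNReal.ofReal (φ n) := hφ ▸ GMMD.lintegral_pathGmmd_le_rate hΦ hT hn μ hμ hμ2
  have hXm : Measurable fun ω i => X i ω := measurable_pi_lambda _ hX
  have hlaw : P.map (fun ω i => X i ω) = Measure.pi fun _ : Fin n => μ := by
    rw [(iIndepFun_iff_map_fun_eq_pi_map fun i => (hX i).aemeasurable).1 hind]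
    simp only [hXμ]
  have hZ := GMMD.measurable_pathGmmd (n := n) hΦ μ
  have hlint : ∀ F : (Fin n → GMMD.PathSpace d T) → ℝ≥0∞, Measurable F →
      ∫⁻ ω, F (fun i => X i ω) ∂P = ∫⁻ x, F x ∂(Measure.pi fun _ : Fin n => μ) := fun F hF => by
    rw [← hlaw, lintegral_map hF hXm]
  refine ⟨hZ.comp hXm, ?_, ?_, ?_⟩
  · exact (hlint _ hZ).trans_le hbound
  -- The supremum of the squares is at most the square of the supremum, to which the moment bound
  -- applies.
  · refine le_trans (lintegral_mono fun ω => ?_) ((hlint _ (hZ.pow_const 2)).trans_le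
      (GMMD.lintegral_sq_pathGmmd_le hΦ hn μ hμ2 hφ0 hbound))
    exact iSup_le fun t => pow_le_pow_left' (le_iSup (fun t => GMMD.gmmd Φ (GMMD.marginal μ t)
      (GMMD.empirical fun i => X i ω t)) t) 2
  · intro κ hκ hT1 a ha
    have h := GMMD.measure_pathGmmd_ge_le hΦ hn μ hμ1 hφ0 hbound hκ hT1 ha
    rw [← hlaw, Measure.map_apply hXm (measurableSet_le measurable_const hZ)] at h
    exact h
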